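/- Let $d\ge1$, let $\Omega\subset\mathbb R^d$ be a bounded open set (for instance a bounded Lipschitz domain), and let $0<\alpha<1$, $T>0$ and $m\ge1$. Write $\langle\cdot,\cdot\rangle$ and $\|\cdot\|$ for the inner product and norm of $L_2(\Omega)$ (or $L_2(\Omega)^d$), and $\omega_\alpha(t)=t^{\alpha-1}/\Gamma(\alpha)$. Let $\kappa\in L_\infty(\Omega)^{d\times d}$ be such that $\kappa(x)$ is real, symmetric and positive definite with minimal eigenvalue bounded away from zero uniformly for almost every $x\in\Omega$, and let $$\vec F,\vec G\in C^{m+1}\bigl([0,T];W^1_\infty(\Omega)^d\bigr),\qquad a,b\in C^m\bigl([0,T];L_\infty(\Omega)\bigr).$$ For $v,w\in H^1_0(\Omega)$ put $$\langle K_1(t)v,w\rangle=\langle\kappa\nabla v,\nabla w\rangle-\langle\vec F(t)v,\nabla w\rangle+\langle a(t)v,w\rangle,\qquad \langle K_2(t)v,w\rangle=\langle b(t)v,w\rangle-\langle\vec G(t)v,\nabla w\rangle,$$ $$\langle K_1'(t)v,w\rangle=-\langle\vec F'(t)v,\nabla w\rangle+\langle a'(t)v,w\rangle,\qquad K(t,s)=\omega_\alpha(t-s)K_1(t)+K_2(s)-\int_s^t\omega_\alpha(z-s)K_1'(z)\,dz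 .$$ Let $X$ be a finite-dimensional subspace of $H^1_0(\Omega)$ with the norm $\|\cdot\|_X=\|\cdot\|_{H^1_0(\Omega)}$, and let $K_X(t,s):X\to X$ be defined by $\langle K_X(t,s)v,w\rangle=\langle K(t,s)v,w\rangle$ for all $v,w\in X$. Let $C^m_\alpha=C^m_\alpha([0,T];X)$ be the space of continuous functions $v:[0,T]\to X$ that are $C^m$ on $(0,T]$ and for which $|v|_{j,\alpha}=\sup_{0<t\le T}t^{j-\alpha}\|v^{(j)}(t)\|_X$ is finite for $1\le j\le m$, with the norm $\|v\|_{m,\alpha}=\max_{0\le t\le T}\|v(t)\|_X+\sum_{j=1}^m|v|_{j,\alpha}$. Then there are positive constants $C_X$ and $C_X'$, depending only on $\Omega$, $\alpha$, $T$, $m$, the coefficients $\kappa,\vec F,\vec G,a,b$ and $X$, such that the following holds. Let $u_0\in L_2(\Omega)$, let $g:(0,T]\to L_2(\Omega)$ be $C^m$, and suppose that $M$ is a constant with $$\|g^{(i-1)}(t)\|\le Mt^{\alpha-i}\qquad\text{for }0<t\le T\text{ and }1\le i\le m.$$ Let $f_X(t)\in X$ be the $L_2(\Omega)$-projection onto $X$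 of $u_0+\int_0^tg(s)\,ds$. Then the Volterra equation $$u_X(t)+\int_0^tK_X(t,s)u_X(s)\,ds=f_X(t)\qquad\text{for }0\le t\le T$$ has a unique continuous solution $u_X:[0,T]\to X$; moreover $f_X\in C^m_\alpha$, $u_X\in C^m_\alpha$, and $$\|u_X\|_{m,\alpha}\le C_X\|f_X\|_{m,\alpha}\le C_X'\bigl(\|u_0\|+M\bigr).$$ -/

import Mathlib

open MeasureTheory Set TopologicalSpace
open scoped ENNReal

noncomputable section

namespace FracPDE

/-! ### Lebesgue and Sobolev spaces on an open set `Ω ⊆ ℝᵈ` -/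

/-- Euclidean space `ℝᵈ`. -/
abbrev E (d : ℕ) : Type := EuclideanSpace ℝ (Fin d)

/-- Lebesgue measure on `Ω`. -/
abbrev vol {d : ℕ} (Ω : Opens (E d)) : Measure (E d) := volume.restrict (Ω : Set (E d))

/-- `L_∞(Ω)`. -/
abbrev Linf {d : ℕ} (Ω : Opens (E d)) : Type := Lp ℝ ∞ (vol Ω)

/-- `L_2(Ω)`. -/
abbrev L2 {d : ℕ} (Ω : Opens (E d)) : Type := Lp ℝ 2 (vol Ω)

/-- The classical partial derivative `∂ᵢ φ`. -/
def pderiv {d : ℕ} (i : Fin d) (φ : E d → ℝ) (x : E d) : ℝ :=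
  fderiv ℝ φ x (EuclideanSpace.single i 1)

/-- `g` is the `i`-th weak partial derivative of `f` on `Ω`. -/
def IsWeakPartial {d : ℕ} (Ω : Opens (E d)) (i : Fin d) (f g : E d → ℝ) : Prop :=
  ∀ φ : TestFunction Ω ℝ ⊤,
    ∫ x in (Ω : Set (E d)), f x * pderiv i φ x = - ∫ x in (Ω : Set (E d)), g x * φ x

section helpers

variable {d : ℕ} {Ω : Opens (E d)}

lemma continuous_pderiv (i : Fin d) (φ : TestFunction Ω ℝ ⊤) : Continuous (pderiv i φ) := by
  have h : ContDiff ℝ 1 φ := φ.contDiff.of_le (by norm_cast)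
  exact (h.continuous_fderiv (by simp)).clm_apply continuous_const

lemma hasCompactSupport_pderiv (i : Fin d) (φ : TestFunction Ω ℝ ⊤) :
    HasCompactSupport (pderiv i φ) :=
  φ.hasCompactSupport.fderiv_apply (𝕜 := ℝ) _

lemma memLp_test (p : ℝ≥0∞) (φ : TestFunction Ω ℝ ⊤) : MemLp φ p (vol Ω) :=
  φ.continuous.memLp_of_hasCompactSupport φ.hasCompactSupport

lemma memLp_pderiv (p : ℝ≥0∞) (i : Fin d) (φ : TestFunction Ω ℝ ⊤) :
    MemLp (pderiv i φ) p (vol Ω) :=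
  (continuous_pderiv i φ).memLp_of_hasCompactSupport (hasCompactSupport_pderiv i φ)

lemma integrable_mul_of_top {f g : E d → ℝ} (hf : MemLp f ∞ (vol Ω)) (hg : MemLp g 1 (vol Ω)) :
    Integrable (fun x => f x * g x) (vol Ω) := by
  have := MemLp.integrable_mul (p := ∞) (q := 1) hf hg
  exact this

end helpers

/-- The Sobolev space `W¹_∞(Ω)`: essentially bounded functions `w.1` together with their
essentially bounded weak partial derivatives `w.2 i`, normed by the maximum of the `L_∞` norms. -/
def W1inf {d : ℕ} (Ω : Opens (E d)) : Submodule ℝ (Linf Ω × (Fin d → Linf Ω)) where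
  carrier := {w | ∀ i, IsWeakPartial Ω i w.1 (w.2 i)}
  zero_mem' := by
    intro i φ
    have h0 : ((0 : Linf Ω) : E d → ℝ) =ᵐ[vol Ω] 0 := Lp.coeFn_zero _ _ _
    have h1 : ∫ x in (Ω : Set (E d)), (0 : Linf Ω) x * pderiv i φ x = 0 := by
      rw [← integral_zero (E d) ℝ (μ := vol Ω)]
      refine integral_congr_ae ?_
      filter_upwards [h0] with x hx
      rw [hx, Pi.zero_apply, zero_mul]
    have h2 : ∫ x in (Ω : Set (E d)), (0 : Linf Ω) x * φ x = 0 := by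
      rw [← integral_zero (E d) ℝ (μ := vol Ω)]
      refine integral_congr_ae ?_
      filter_upwards [h0] with x hx
      rw [hx, Pi.zero_apply, zero_mul]
    change ∫ x in (Ω : Set (E d)), (0 : Linf Ω) x * pderiv i φ x
      = - ∫ x in (Ω : Set (E d)), (0 : Linf Ω) x * φ x
    rw [h1, h2, neg_zero]
  add_mem' := by
    intro v w hv hw i φ
    have key : ∀ (f g : Linf Ω) (ψ : E d → ℝ), MemLp ψ 1 (vol Ω) →
        ∫ x in (Ω : Set (E d)), (f + g : Linf Ω) x * ψ x
          = (∫ x in (Ω : Set (E d)), f x * ψ x) + ∫ x in (Ω : Set (E d)), g x * ψ x := by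
      intro f g ψ hψ
      rw [← integral_add (integrable_mul_of_top (Lp.memLp f) hψ)
        (integrable_mul_of_top (Lp.memLp g) hψ)]
      refine integral_congr_ae ?_
      filter_upwards [Lp.coeFn_add f g] with x hx
      rw [hx, Pi.add_apply, add_mul]
    change ∫ x in (Ω : Set (E d)), (v.1 + w.1 : Linf Ω) x * pderiv i φ x
      = - ∫ x in (Ω : Set (E d)), (v.2 i + w.2 i : Linf Ω) x * φ x
    rw [key _ _ _ (memLp_pderiv 1 i φ), key _ _ _ (memLp_test 1 φ), hv i φ, hw i φ]
    ring
  smul_mem' := by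
    intro c w hw i φ
    have key : ∀ (f : Linf Ω) (ψ : E d → ℝ),
        ∫ x in (Ω : Set (E d)), (c • f : Linf Ω) x * ψ x
          = c * ∫ x in (Ω : Set (E d)), f x * ψ x := by
      intro f ψ
      rw [← integral_const_mul]
      refine integral_congr_ae ?_
      filter_upwards [Lp.coeFn_smul c f] with x hx
      rw [hx, Pi.smul_apply, smul_eq_mul, mul_assoc]
    change ∫ x in (Ω : Set (E d)), (c • w.1 : Linf Ω) x * pderiv i φ x
      = - ∫ x in (Ω : Set (E d)), (c • w.2 i : Linf Ω) x * φ x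
    rw [key, key, hw i φ]
    ring

/-- Pairs (function, gradient) in `L_2(Ω) × L_2(Ω)ᵈ`, with the norm of `H¹(Ω)`,
`‖(v, p)‖² = ‖v‖² + ∑ᵢ ‖pᵢ‖²`. -/
abbrev Pair {d : ℕ} (Ω : Opens (E d)) : Type :=
  WithLp 2 (L2 Ω × PiLp 2 (fun _ : Fin d => L2 Ω))

/-- `H¹₀(Ω)` as a subspace of the pairs: the closure of the test functions `C_c^∞(Ω)` in the norm
of `H¹(Ω)`. An element is the pair consisting of a function and its weak gradient. -/
def H10Submodule {d : ℕ} (Ω : Opens (E d)) : Submodule ℝ (Pair Ω) :=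
  (Submodule.span ℝ {w : Pair Ω | ∃ φ : TestFunction Ω ℝ ⊤,
    w.fst =ᵐ[vol Ω] φ ∧ ∀ i, w.snd i =ᵐ[vol Ω] pderiv i φ}).topologicalClosure

/-- The Hilbert space `H¹₀(Ω)`. -/
def H10 {d : ℕ} (Ω : Opens (E d)) : Type := H10Submodule Ω

instance {d : ℕ} (Ω : Opens (E d)) : NormedAddCommGroup (H10 Ω) :=
  inferInstanceAs (NormedAddCommGroup (H10Submodule Ω))

instance {d : ℕ} (Ω : Opens (E d)) : InnerProductSpace ℝ (H10 Ω) :=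
  inferInstanceAs (InnerProductSpace ℝ (H10Submodule Ω))

/-- The inclusion of `H¹₀(Ω)` into the pairs (function, gradient). -/
def toPair {d : ℕ} (Ω : Opens (E d)) : H10 Ω →L[ℝ] Pair Ω := (H10Submodule Ω).subtypeL

/-- The embedding `H¹₀(Ω) → L_2(Ω)`. -/
def val {d : ℕ} (Ω : Opens (E d)) : H10 Ω →L[ℝ] L2 Ω :=
  (WithLp.fstL 2 ℝ (L2 Ω) (PiLp 2 (fun _ : Fin d => L2 Ω))).comp (toPair Ω)

/-- The `i`-th partial derivative `H¹₀(Ω) → L_2(Ω)`. -/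
def grad {d : ℕ} (Ω : Opens (E d)) (i : Fin d) : H10 Ω →L[ℝ] L2 Ω :=
  ((PiLp.proj 2 (fun _ : Fin d => L2 Ω) i : PiLp 2 (fun _ : Fin d => L2 Ω) →L[ℝ] L2 Ω).comp
    (WithLp.sndL 2 ℝ (L2 Ω) (PiLp 2 (fun _ : Fin d => L2 Ω)))).comp (toPair Ω)

/-- Elements of `H¹₀(Ω)` satisfy the defining relation of the weak derivative. -/
lemma inner_val_pderiv {d : ℕ} {Ω : Opens (E d)} (v : H10 Ω) (i : Fin d)
    (φ : TestFunction Ω ℝ ⊤) :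
    inner ℝ ((memLp_pderiv 2 i φ).toLp _) (val Ω v)
      = - inner ℝ ((memLp_test 2 φ).toLp _) (grad Ω i v) := by
  obtain ⟨v, hv⟩ := v
  change inner ℝ ((memLp_pderiv 2 i φ).toLp _) v.fst
      = - inner ℝ ((memLp_test 2 φ).toLp _) (v.snd i)
  let A : Pair Ω →L[ℝ] ℝ :=
    (innerSL ℝ ((memLp_pderiv 2 i φ).toLp _)).comp
      (WithLp.fstL 2 ℝ (L2 Ω) (PiLp 2 (fun _ : Fin d => L2 Ω))) +
    (innerSL ℝ ((memLp_test 2 φ).toLp _)).comp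
      ((PiLp.proj 2 (fun _ : Fin d => L2 Ω) i : PiLp 2 (fun _ : Fin d => L2 Ω) →L[ℝ] L2 Ω).comp
        (WithLp.sndL 2 ℝ (L2 Ω) (PiLp 2 (fun _ : Fin d => L2 Ω))))
  have hA : ∀ w, A w = inner ℝ ((memLp_pderiv 2 i φ).toLp _) w.fst
      + inner ℝ ((memLp_test 2 φ).toLp _) (w.snd i) := fun w => rfl
  have hle : H10Submodule Ω ≤ LinearMap.ker (A : Pair Ω →ₗ[ℝ] ℝ) := by
    refine Submodule.topologicalClosure_minimal _ ?_ A.isClosed_ker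
    rw [Submodule.span_le]
    rintro w ⟨ψ, h1, h2⟩
    change A w = 0
    rw [hA, MeasureTheory.L2.inner_def, MeasureTheory.L2.inner_def]
    have e1 : ∫ x, inner ℝ ((memLp_pderiv 2 i φ).toLp _ x) (w.fst x) ∂(vol Ω)
        = ∫ x, ψ x * pderiv i φ x := by
      rw [eq_comm, ← setIntegral_eq_integral_of_forall_compl_eq_zero (s := (Ω : Set (E d)))]
      · refine integral_congr_ae ?_
        filter_upwards [h1, (memLp_pderiv 2 i φ).coeFn_toLp] with x hx hx'
        rw [hx, hx']; simp
      · intro x hx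
        rw [image_eq_zero_of_notMem_tsupport (fun h => hx (ψ.tsupport_subset h)), zero_mul]
    have e2 : ∫ x, inner ℝ ((memLp_test 2 φ).toLp _ x) (w.snd i x) ∂(vol Ω)
        = ∫ x, pderiv i ψ x * φ x := by
      rw [eq_comm, ← setIntegral_eq_integral_of_forall_compl_eq_zero (s := (Ω : Set (E d)))]
      · refine integral_congr_ae ?_
        filter_upwards [h2 i, (memLp_test 2 φ).coeFn_toLp] with x hx hx'
        rw [hx, hx']; simp [mul_comm]
      · intro x hx
        rw [image_eq_zero_of_notMem_tsupport (fun h => hx (φ.tsupport_subset h)), mul_zero]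
    rw [e1, e2]
    have hdiff : ∀ χ : TestFunction Ω ℝ ⊤, Differentiable ℝ χ := fun χ =>
      χ.contDiff.differentiable (by simp)
    have := integral_mul_fderiv_eq_neg_fderiv_mul_of_integrable (μ := (volume : Measure (E d)))
      (f := ψ) (g := φ) (v := EuclideanSpace.single i 1)
      (((continuous_pderiv i ψ).mul φ.continuous).integrable_of_hasCompactSupport
        φ.hasCompactSupport.mul_left)
      ((ψ.continuous.mul (continuous_pderiv i φ)).integrable_of_hasCompactSupport
        ψ.hasCompactSupport.mul_right)
      ((ψ.continuous.mul φ.continuous).integrable_of_hasCompactSupport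
        ψ.hasCompactSupport.mul_right)
      (fun x _ => hdiff ψ x) (fun x _ => hdiff φ x)
    have h' : ∫ x, ψ x * pderiv i φ x = - ∫ x, pderiv i ψ x * φ x := this
    rw [h']; ring
  have := hle hv
  have h0 : A v = 0 := this
  rw [hA] at h0
  linarith

/-- An element of `H¹₀(Ω)` is determined by its underlying function. -/
lemma val_injective {d : ℕ} (Ω : Opens (E d)) : Function.Injective (val Ω) := by
  rw [injective_iff_map_eq_zero]
  intro v hv
  have hg : ∀ i, grad Ω i v = 0 := by
    intro i
    have h := fun φ => inner_val_pderiv v i φ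
    simp only [hv, inner_zero_right] at h
    have h2 : ∀ᵐ x ∂(volume : Measure (E d)), x ∈ (Ω : Set (E d)) → grad Ω i v x = 0 := by
      refine Ω.isOpen.ae_eq_zero_of_integral_contDiff_smul_eq_zero ?_ ?_
      · have hm := Lp.memLp (grad Ω i v)
        rw [locallyIntegrableOn_iff Ω.isOpen.isLocallyClosed]
        intro k hk hkc
        have hk' : MemLp (grad Ω i v) 2 (volume.restrict k) :=
          hm.mono_measure (Measure.restrict_mono hk le_rfl)
        have : IsFiniteMeasure ((volume : Measure (E d)).restrict k) :=
          ⟨by rw [Measure.restrict_apply_univ]; exact hkc.measure_lt_top⟩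
        exact hk'.integrable (by norm_num)
      · intro φ h1 h2 h3
        let χ : TestFunction Ω ℝ ⊤ := ⟨φ, h1, h2, h3⟩
        have := h χ
        rw [MeasureTheory.L2.inner_def] at this
        rw [← setIntegral_eq_integral_of_forall_compl_eq_zero (s := (Ω : Set (E d)))]
        · rw [zero_eq_neg] at this
          rw [← this]
          refine integral_congr_ae ?_
          filter_upwards [(memLp_test 2 χ).coeFn_toLp] with x hx
          rw [hx, real_inner_comm]
          simp [χ]
        · intro x hx
          rw [image_eq_zero_of_notMem_tsupport (fun h => hx (h3 h)), zero_smul]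
    rw [Lp.eq_zero_iff_ae_eq_zero]
    exact (ae_restrict_iff' Ω.isOpen.measurableSet).2 h2
  apply Subtype.ext
  apply WithLp.ofLp_injective
  refine Prod.ext hv ?_
  apply PiLp.ext
  exact hg

/-! ### The operators of the fractional problem -/

/-- The coefficients `κ`, `F`, `G`, `a`, `b`; the last four depend on time. -/
structure Coeffs {d : ℕ} (Ω : Opens (E d)) where
  κ : Matrix (Fin d) (Fin d) (Linf Ω)
  F : ℝ → Fin d → W1inf Ω
  G : ℝ → Fin d → W1inf Ω
  a : ℝ → Linf Ω
  b : ℝ → Linf Ω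

/-- Multiplication `L_∞(Ω) × L_2(Ω) → L_2(Ω)`. -/
def mulL {d : ℕ} (Ω : Opens (E d)) : Linf Ω →L[ℝ] L2 Ω →L[ℝ] L2 Ω :=
  (ContinuousLinearMap.mul ℝ ℝ).holderL (vol Ω) ∞ 2 2

lemma mulL_coe {d : ℕ} {Ω : Opens (E d)} (c : Linf Ω) (v : L2 Ω) :
    mulL Ω c v =ᵐ[vol Ω] fun x => c x * v x :=
  (ContinuousLinearMap.mul ℝ ℝ).coeFn_holder c v

/-- `⟨κ∇v, ∇w⟩`, as a bounded operator `H¹₀(Ω) → H⁻¹(Ω)`. -/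
def diffusion {d : ℕ} {Ω : Opens (E d)} (κ : Matrix (Fin d) (Fin d) (Linf Ω)) :
    H10 Ω →L[ℝ] StrongDual ℝ (H10 Ω) :=
  ∑ i, ∑ j, (innerSL ℝ).bilinearComp ((mulL Ω (κ i j)).comp (grad Ω j)) (grad Ω i)

/-- `⟨F v, ∇w⟩`, as a bounded operator `L_2(Ω) → H⁻¹(Ω)`. -/
def drift {d : ℕ} {Ω : Opens (E d)} (F : Fin d → W1inf Ω) :
    L2 Ω →L[ℝ] StrongDual ℝ (H10 Ω) :=
  ∑ i, (innerSL ℝ).bilinearComp (mulL Ω (F i).1.1) (grad Ω i)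

/-- `⟨a v, w⟩`, as a bounded operator `L_2(Ω) → H⁻¹(Ω)`. -/
def reaction {d : ℕ} {Ω : Opens (E d)} (a : Linf Ω) :
    L2 Ω →L[ℝ] StrongDual ℝ (H10 Ω) :=
  (innerSL ℝ).bilinearComp (mulL Ω a) (val Ω)

lemma diffusion_apply {d : ℕ} {Ω : Opens (E d)} (κ : Matrix (Fin d) (Fin d) (Linf Ω))
    (v w : H10 Ω) :
    diffusion κ v w = ∑ i, ∑ j, inner ℝ (mulL Ω (κ i j) (grad Ω j v)) (grad Ω i w) := by
  simp [diffusion]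

lemma drift_apply {d : ℕ} {Ω : Opens (E d)} (F : Fin d → W1inf Ω) (v : L2 Ω) (w : H10 Ω) :
    drift F v w = ∑ i, inner ℝ (mulL Ω (F i).1.1 v) (grad Ω i w) := by
  simp [drift]

lemma reaction_apply {d : ℕ} {Ω : Opens (E d)} (a : Linf Ω) (v : L2 Ω) (w : H10 Ω) :
    reaction a v w = inner ℝ (mulL Ω a v) (val Ω w) := by
  simp [reaction]

/-- `⟨K₁(t)v, w⟩ = ⟨κ∇v, ∇w⟩ - ⟨F(t)v, ∇w⟩ + ⟨a(t)v, w⟩`. -/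
def K1 {d : ℕ} {Ω : Opens (E d)} (c : Coeffs Ω) (t : ℝ) : H10 Ω →L[ℝ] StrongDual ℝ (H10 Ω) :=
  diffusion c.κ - (drift (c.F t)).comp (val Ω) + (reaction (c.a t)).comp (val Ω)

/-- `⟨K₁'(t)v, w⟩ = -⟨F'(t)v, ∇w⟩ + ⟨a'(t)v, w⟩`, with the time derivatives taken on `[0,T]`. -/
def K1' {d : ℕ} {Ω : Opens (E d)} (c : Coeffs Ω) (T t : ℝ) :
    H10 Ω →L[ℝ] StrongDual ℝ (H10 Ω) :=
  -(drift (derivWithin c.F (Icc 0 T) t)).comp (val Ω)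
    + (reaction (derivWithin c.a (Icc 0 T) t)).comp (val Ω)

/-- `⟨K₂(t)v, w⟩ = ⟨b(t)v, w⟩ - ⟨G(t)v, ∇w⟩`. -/
def K2 {d : ℕ} {Ω : Opens (E d)} (c : Coeffs Ω) (t : ℝ) : L2 Ω →L[ℝ] StrongDual ℝ (H10 Ω) :=
  reaction (c.b t) - drift (c.G t)

/-- `ω_α(t) = t^(α-1) / Γ(α)`. -/
def omega (α t : ℝ) : ℝ := t ^ (α - 1) / Real.Gamma α

/-- The kernel `K(t,s) = ω_α(t-s) K₁(t) + K₂(s) - ∫_s^t ω_α(z-s) K₁'(z) dz`. -/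
def K {d : ℕ} {Ω : Opens (E d)} (c : Coeffs Ω) (α T t s : ℝ) :
    H10 Ω →L[ℝ] StrongDual ℝ (H10 Ω) :=
  omega α (t - s) • K1 c t + (K2 c s).comp (val Ω) - ∫ z in s..t, omega α (z - s) • K1' c T z

/-! ### The projected Volterra equation -/

section projected

variable {d : ℕ} {Ω : Opens (E d)} (X : Submodule ℝ (H10 Ω))

/-- The embedding `X → L_2(Ω)` of a subspace `X ⊆ H¹₀(Ω)`. -/
def valX : X →L[ℝ] L2 Ω := (val Ω).comp X.subtypeL

/-- The `L_2` inner product on `X`. -/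
def gram : LinearMap.BilinForm ℝ X :=
  (innerₗ (L2 Ω)).compl₁₂ (valX X : X →ₗ[ℝ] L2 Ω) (valX X : X →ₗ[ℝ] L2 Ω)

lemma gram_apply (v w : X) : gram X v w = inner ℝ (valX X v) (valX X w) := rfl

lemma gram_nondegenerate : (gram X).Nondegenerate := by
  have h : ∀ v : X, gram X v v = 0 → v = 0 := by
    intro v hv
    rw [gram_apply, inner_self_eq_zero] at hv
    have : val Ω v.1 = val Ω 0 := by rw [map_zero]; exact hv
    exact Subtype.ext (val_injective Ω this)
  exact ⟨fun v hv => h v (hv v), fun v hv => h v (hv v)⟩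

variable [FiniteDimensional ℝ X]

/-- The element `x` of `X` with `⟨x, w⟩ = ℓ w` for all `w ∈ X`, the brackets denoting the inner
product of `L_2(Ω)`. -/
def represent : Module.Dual ℝ X ≃ₗ[ℝ] X :=
  ((gram X).toDual (gram_nondegenerate X)).symm

lemma represent_spec (ℓ : Module.Dual ℝ X) (w : X) :
    inner ℝ (valX X (represent X ℓ)) (valX X w) = ℓ w := by
  rw [← gram_apply]
  exact LinearMap.BilinForm.apply_toDual_symm_apply (hB := gram_nondegenerate X) ℓ w

/-- The operator `K_X(t,s) : X → X`, with `⟨K_X(t,s)v, w⟩ = ⟨K(t,s)v, w⟩` for `v, w ∈ X`. -/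
def KX (c : Coeffs Ω) (α T t s : ℝ) : X →L[ℝ] X :=
  LinearMap.toContinuousLinearMap
    { toFun := fun v => represent X ((K c α T t s v.1 : H10 Ω →ₗ[ℝ] ℝ) ∘ₗ X.subtype)
      map_add' := by
        intro v w
        rw [← map_add]
        congr 1
        ext x
        simp
      map_smul' := by
        intro r v
        rw [RingHom.id_apply, ← map_smul]
        congr 1
        ext x
        simp }

lemma KX_spec (c : Coeffs Ω) (α T t s : ℝ) (v w : X) :
    inner ℝ (valX X (KX X c α T t s v)) (valX X w) = K c α T t s v.1 w.1 :=
  represent_spec X _ w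

/-- The `L_2` projection onto `X`: `⟨projX f, w⟩ = ⟨f, w⟩` for `w ∈ X`. -/
def projX (f : L2 Ω) : X := represent X (innerₗ (L2 Ω) f ∘ₗ (valX X : X →ₗ[ℝ] L2 Ω))

lemma projX_spec (f : L2 Ω) (w : X) :
    inner ℝ (valX X (projX X f)) (valX X w) = inner ℝ f (valX X w) :=
  represent_spec X _ w

/-- `f_X(t)`, the `L_2` projection onto `X` of `f(t) = u₀ + ∫₀ᵗ g(s) ds`. -/
def fX (u₀ : L2 Ω) (g : ℝ → L2 Ω) (t : ℝ) : X := projX X (u₀ + ∫ s in (0 : ℝ)..t, g s)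

/-- `u` is continuous on `[0,T]` and solves the projected Volterra equation
`u(t) + ∫₀ᵗ K_X(t,s) u(s) ds = f_X(t)` for `0 ≤ t ≤ T`. -/
structure IsSolution (c : Coeffs Ω) (α T : ℝ) (u₀ : L2 Ω) (g : ℝ → L2 Ω) (u : ℝ → X) : Prop where
  continuousOn : ContinuousOn u (Icc 0 T)
  eqn : ∀ t ∈ Icc 0 T, IntervalIntegrable (fun s => KX X c α T t s (u s)) volume 0 t ∧
    u t + ∫ s in (0 : ℝ)..t, KX X c α T t s (u s) = fX X u₀ g t

end projected

/-! ### The weighted space `C^m_α([0,T];Y)` -/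

section weighted

variable {Y : Type*} [NormedAddCommGroup Y] [NormedSpace ℝ Y]

/-- The quantities whose supremum over `0 < t ≤ T` is the seminorm `|v|_{j,α}`. -/
def weightedValues (α T : ℝ) (j : ℕ) (v : ℝ → Y) : Set ℝ :=
  (fun t : ℝ => t ^ ((j : ℝ) - α) * ‖iteratedDerivWithin j v (Ioc 0 T) t‖) '' Ioc 0 T

/-- The seminorm `|v|_{j,α} = sup_{0<t≤T} t^(j-α) ‖v^{(j)}(t)‖`. -/
def weightedSeminorm (α T : ℝ) (j : ℕ) (v : ℝ → Y) : ℝ := sSup (weightedValues α T j v)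

/-- Membership in `C^m_α([0,T];Y)`. -/
structure MemWeighted (m : ℕ) (α T : ℝ) (v : ℝ → Y) : Prop where
  continuousOn : ContinuousOn v (Icc 0 T)
  contDiffOn : ContDiffOn ℝ m v (Ioc 0 T)
  bounded : ∀ j ∈ Finset.Icc 1 m, BddAbove (weightedValues α T j v)

/-- The norm `‖v‖_{m,α} = max_{0≤t≤T} ‖v(t)‖ + ∑_{j=1}^m |v|_{j,α}`. -/
def weightedNorm (m : ℕ) (α T : ℝ) (v : ℝ → Y) : ℝ :=
  sSup ((fun t => ‖v t‖) '' Icc 0 T) + ∑ j ∈ Finset.Icc 1 m, weightedSeminorm α T j v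

end weighted

end FracPDE

end

/-! Write `B`, `B'`, `D` for the compressions to X of K₁, K₁' and K₂. Inserting the kernel and
exchanging the order of integration turns the integral operator into `B I^α u + ∫ (D u - B' I^α u)`,
where `I^α` is the fractional integral (`integral_kernel_apply`, `integral_KX_apply`). Finite
dimension of X makes the compression bounded, so these coefficients are as smooth in time as the
data.

Well-posedness comes from exponential weights. In the norm `sup e^(-μt)‖u(t)‖` the operator has size
`O(μ^(-β))` with `β = α/2`, hence is a contraction for large `μ`. This gives existence, uniqueness
and a sup bound (`exists_solution`, `exists_apriori`). The structure `IsVolterra` also records a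
factor `t^β`, which keeps `s⁻¹ V u(s)` integrable at the origin.

Regularity rests on dilations. Since `I^α u(t) = t^α ∫₀¹ ω_α(1-σ) u(tσ) dσ`, the derivative `t d/dt`
sends `I^α u` to `α I^α u + I^α(t u')`. Applied to `u + B I^α u = h`, it yields for `w = t u'` an
equation with the same operator and with right-hand side `t h' - (t B' + α B) I^α u`, where here
`B'` is the derivative of `B`. Bounds on `w` of order k are bounds on `u` of order k+1, and one
argues by induction (`exists_weightedBound_of_frac_eq`). For the full equation, the terms `∫ (D u -
B' I^α u)` are moved to the right; being primitives, they have one more derivative than is already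
known for `u` (`exists_weightedBound_of_volterraOp_eq`). The data `f_X` fit because `f_X'` is the
projection of `g`. -/

noncomputable section

namespace FracPDE

set_option linter.unusedSectionVars false

open Filter Topology

/-! ### Abstract Volterra operators -/

section volterra

variable {Y : Type*} [NormedAddCommGroup Y] [NormedSpace ℝ Y]

/-- A linear operator on continuous functions on `[0,T]`, small of order `β` at the origin, whose
norm with respect to exponentially weighted supremum norms decays with the weight. -/
structure IsVolterra (T β : ℝ) (V : (ℝ → Y) → ℝ → Y) : Prop where
  continuousOn : ∀ u, ContinuousOn u (Icc 0 T) → ContinuousOn (V u) (Icc 0 T)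
  map_sub : ∀ u v, ContinuousOn u (Icc 0 T) → ContinuousOn v (Icc 0 T) →
    ∀ t ∈ Icc 0 T, V (u - v) t = V u t - V v t
  bound : ∃ C, 0 ≤ C ∧ ∀ μ, 1 ≤ μ → ∀ u N, ContinuousOn u (Icc 0 T) → 0 ≤ N →
    (∀ s ∈ Icc 0 T, ‖u s‖ ≤ N * Real.exp (μ * s)) →
    ∀ t ∈ Icc 0 T, ‖V u t‖ ≤ C * μ ^ (-β) * N * t ^ β * Real.exp (μ * t)

namespace IsVolterra

variable {T β : ℝ} {V W : (ℝ → Y) → ℝ → Y}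

/-- For some exponential weight, the operator is a contraction. -/
lemma exists_contraction (hV : IsVolterra T β V) (hβ : 0 < β) :
    ∃ μ, 1 ≤ μ ∧ ∀ u N, ContinuousOn u (Icc 0 T) → 0 ≤ N →
      (∀ s ∈ Icc 0 T, ‖u s‖ ≤ N * Real.exp (μ * s)) →
      ∀ t ∈ Icc 0 T, ‖V u t‖ ≤ 1 / 2 * (N * Real.exp (μ * t)) := by
  obtain ⟨C, hC, hb⟩ := hV.bound
  have h0 : Tendsto (fun μ : ℝ => C * μ ^ (-β) * T ^ β) atTop (𝓝 (C * 0 * T ^ β)) :=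
    ((tendsto_rpow_neg_atTop hβ).const_mul C).mul_const _
  rw [mul_zero, zero_mul] at h0
  obtain ⟨μ, h1, h2⟩ := ((h0.eventually_lt_const (by norm_num : (0 : ℝ) < 1 / 2)).and
    (eventually_ge_atTop 1)).exists
  refine ⟨μ, h2, fun u N hu hN h t ht => (hb μ h2 u N hu hN h t ht).trans ?_⟩
  have h3 : t ^ β ≤ T ^ β := Real.rpow_le_rpow ht.1 ht.2 hβ.le
  have h4 : C * μ ^ (-β) * t ^ β ≤ 1 / 2 :=
    (mul_le_mul_of_nonneg_left h3 (by positivity)).trans h1.le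
  calc C * μ ^ (-β) * N * t ^ β * Real.exp (μ * t)
      = C * μ ^ (-β) * t ^ β * (N * Real.exp (μ * t)) := by ring
    _ ≤ _ := mul_le_mul_of_nonneg_right h4 (by positivity)

/-- Stability of the second-kind equation `u + V u = f`. -/
lemma exists_apriori (hV : IsVolterra T β V) (hβ : 0 < β) :
    ∃ C, 1 ≤ C ∧ ∀ u N, ContinuousOn u (Icc 0 T) → (∀ t ∈ Icc 0 T, ‖u t + V u t‖ ≤ N) →
      ∀ t ∈ Icc 0 T, ‖u t‖ ≤ C * N := by
  obtain ⟨μ, hμ, hc⟩ := hV.exists_contraction hβ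
  -- The contraction gives the weighted bound 2N; removing the weight on [0,T] costs the
  -- exponential.
  refine ⟨2 * Real.exp (μ * |T|), ?_, fun u N hu h t ht => ?_⟩
  · have : 1 ≤ Real.exp (μ * |T|) := Real.one_le_exp (by positivity)
    linarith
  have hT : 0 ≤ T := ht.1.trans ht.2
  obtain ⟨t₀, ht₀, hmax⟩ := isCompact_Icc.exists_isMaxOn ⟨t, ht⟩
    (show ContinuousOn (fun s => Real.exp (-(μ * s)) * ‖u s‖) (Icc 0 T) from
      (by fun_prop : Continuous fun s => Real.exp (-(μ * s))).continuousOn.mul hu.norm)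
  set P := Real.exp (-(μ * t₀)) * ‖u t₀‖ with hP
  have hP0 : 0 ≤ P := by positivity
  have hu' : ∀ s ∈ Icc 0 T, ‖u s‖ ≤ P * Real.exp (μ * s) := by
    intro s hs
    have h1 : Real.exp (-(μ * s)) * ‖u s‖ ≤ P := hmax hs
    calc ‖u s‖ = Real.exp (-(μ * s)) * ‖u s‖ * Real.exp (μ * s) := by
          rw [mul_right_comm, ← Real.exp_add]; simp
      _ ≤ _ := by gcongr
  have h1 := hc u P hu hP0 hu' t₀ ht₀
  have h2 : ‖u t₀‖ = P * Real.exp (μ * t₀) := by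
    rw [hP, mul_right_comm, ← Real.exp_add]; simp
  have h3 : ‖u t₀‖ ≤ N + 1 / 2 * (P * Real.exp (μ * t₀)) := by
    calc ‖u t₀‖ = ‖(u t₀ + V u t₀) - V u t₀‖ := by rw [add_sub_cancel_right]
      _ ≤ ‖u t₀ + V u t₀‖ + ‖V u t₀‖ := norm_sub_le _ _
      _ ≤ _ := add_le_add (h t₀ ht₀) h1
  have h4 : 1 ≤ Real.exp (μ * t₀) := Real.one_le_exp (by have := ht₀.1; positivity)
  -- At the maximum point `t₀` of the weighted norm, half of `P e^(μt₀)` is absorbed into the left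
  -- side, and `e^(μt₀) ≥ 1`.
  have h5 : P ≤ 2 * N := by nlinarith
  calc ‖u t‖ ≤ P * Real.exp (μ * t) := hu' t ht
    _ ≤ 2 * N * Real.exp (μ * |T|) := by
        have h7 : 0 ≤ 2 * N := hP0.trans h5
        have h6 : t ≤ |T| := ht.2.trans (le_abs_self T)
        gcongr
    _ = _ := by ring

/-- Stability with zero data, applied to the difference. -/
lemma eqOn_of_add_eq (hV : IsVolterra T β V) (hβ : 0 < β) {u v : ℝ → Y}
    (hu : ContinuousOn u (Icc 0 T)) (hv : ContinuousOn v (Icc 0 T))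
    (h : ∀ t ∈ Icc 0 T, u t + V u t = v t + V v t) : EqOn u v (Icc 0 T) := by
  obtain ⟨C, -, hC⟩ := hV.exists_apriori hβ
  intro t ht
  have := hC (u - v) 0 (hu.sub hv) (fun s hs => by
    rw [Pi.sub_apply, hV.map_sub u v hu hv s hs]
    have : u s - v s + (V u s - V v s) = 0 := by
      rw [← sub_eq_zero.2 (h s hs)]; abel
    rw [this, norm_zero]) t ht
  rw [mul_zero] at this
  exact sub_eq_zero.1 (norm_le_zero_iff.1 this)

/-- Existence for the second-kind equation `u + V u = f`. -/
lemma exists_solution [CompleteSpace Y] (hV : IsVolterra T β V) (hβ : 0 < β) (hT : 0 ≤ T)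
    {f : ℝ → Y} (hf : ContinuousOn f (Icc 0 T)) :
    ∃ u, ContinuousOn u (Icc 0 T) ∧ ∀ t ∈ Icc 0 T, u t + V u t = f t := by
  obtain ⟨μ, hμ, hc⟩ := hV.exists_contraction hβ
  -- The unknown is `v = e^(-μs) u`, so the ordinary sup metric on `C([0,T], Y)` is the weighted one
  -- and Banach's theorem applies directly.
  let ext : C(Icc 0 T, Y) → ℝ → Y := fun v s => Real.exp (μ * s) • v (projIcc 0 T hT s)
  have hext : ∀ v, ContinuousOn (ext v) (Icc 0 T) := fun v =>
    ((by fun_prop : Continuous fun s => Real.exp (μ * s)).smul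
      (v.continuous.comp continuous_projIcc)).continuousOn
  let Φ : C(Icc 0 T, Y) → C(Icc 0 T, Y) := fun v =>
    ⟨(Icc 0 T).domRestrict fun t => Real.exp (-(μ * t)) • (f t - V (ext v) t),
      continuousOn_iff_continuous_domRestrict.1
        ((by fun_prop : Continuous fun s => Real.exp (-(μ * s))).continuousOn.smul
          (hf.sub (hV.continuousOn _ (hext v))))⟩
  have hΦ : ContractingWith (1 / 2 : NNReal) Φ := by
    refine ⟨by rw [← NNReal.coe_lt_coe]; norm_num, LipschitzWith.of_dist_le_mul fun v w => ?_⟩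
    rw [ContinuousMap.dist_le (by positivity)]
    rintro ⟨t, ht⟩
    have h1 : ∀ s ∈ Icc 0 T, ‖ext v s - ext w s‖ ≤ dist v w * Real.exp (μ * s) := by
      intro s hs
      simp only [ext]
      rw [← smul_sub, norm_smul, ← dist_eq_norm, Real.norm_of_nonneg (Real.exp_nonneg _), mul_comm]
      gcongr
      exact ContinuousMap.dist_apply_le_dist _
    have h2 := hc _ _ ((hext v).sub (hext w)) dist_nonneg h1 t ht
    rw [hV.map_sub _ _ (hext v) (hext w) t ht] at h2
    change dist (Real.exp (-(μ * t)) • (f t - V (ext v) t))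
      (Real.exp (-(μ * t)) • (f t - V (ext w) t)) ≤ _
    rw [dist_eq_norm, ← smul_sub, norm_smul, sub_sub_sub_cancel_left, norm_sub_rev,
      Real.norm_of_nonneg (Real.exp_nonneg _)]
    calc Real.exp (-(μ * t)) * ‖V (ext v) t - V (ext w) t‖
        ≤ Real.exp (-(μ * t)) * (1 / 2 * (dist v w * Real.exp (μ * t))) := by gcongr
      _ = 1 / 2 * dist v w * (Real.exp (-(μ * t)) * Real.exp (μ * t)) := by ring
      _ = _ := by rw [← Real.exp_add]; simp
  have : Nonempty C(Icc 0 T, Y) := ⟨0⟩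
  have hfix : Φ (hΦ.fixedPoint Φ) = hΦ.fixedPoint Φ := hΦ.fixedPoint_isFixedPt
  set v := hΦ.fixedPoint Φ
  refine ⟨ext v, hext v, fun t ht => ?_⟩
  have h1 : v ⟨t, ht⟩ = Real.exp (-(μ * t)) • (f t - V (ext v) t) := by
    conv_lhs => rw [← hfix]
    rfl
  have h2 : ext v t = f t - V (ext v) t := by
    have : ext v t = Real.exp (μ * t) • v ⟨t, ht⟩ := by
      simp only [ext]; rw [projIcc_of_mem hT ht]
    rw [this, h1, smul_smul, ← Real.exp_add]; simp
  rw [h2]; abel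

lemma add (hV : IsVolterra T β V) (hW : IsVolterra T β W) :
    IsVolterra T β fun u t => V u t + W u t where
  continuousOn u hu := (hV.continuousOn u hu).add (hW.continuousOn u hu)
  map_sub u v hu hv t ht := by
    rw [hV.map_sub u v hu hv t ht, hW.map_sub u v hu hv t ht]; abel
  bound := by
    obtain ⟨C, hC, h⟩ := hV.bound
    obtain ⟨D, hD, h'⟩ := hW.bound
    refine ⟨C + D, by positivity, fun μ hμ u N hu hN hb t ht => ?_⟩
    refine (norm_add_le _ _).trans
      ((add_le_add (h μ hμ u N hu hN hb t ht) (h' μ hμ u N hu hN hb t ht)).trans_eq ?_)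
    ring

lemma neg (hV : IsVolterra T β V) : IsVolterra T β fun u t => -V u t where
  continuousOn u hu := (hV.continuousOn u hu).neg
  map_sub u v hu hv t ht := by rw [hV.map_sub u v hu hv t ht]; abel
  bound := by simpa only [norm_neg] using hV.bound

lemma sub (hV : IsVolterra T β V) (hW : IsVolterra T β W) :
    IsVolterra T β fun u t => V u t - W u t := by
  simpa only [sub_eq_add_neg] using hV.add hW.neg

end IsVolterra

lemma exists_norm_le_of_continuousOn {T : ℝ} {Z : Type*} [SeminormedAddCommGroup Z] {B : ℝ → Z}
    (hB : ContinuousOn B (Icc 0 T)) : ∃ b, 0 ≤ b ∧ ∀ t ∈ Icc 0 T, ‖B t‖ ≤ b := by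
  obtain ⟨b, hb⟩ := isCompact_Icc.exists_bound_of_continuousOn hB
  exact ⟨max b 0, le_max_right _ _, fun t ht => (hb t ht).trans (le_max_left _ _)⟩

namespace IsVolterra

variable {T β : ℝ} {V W : (ℝ → Y) → ℝ → Y}

lemma clm_apply (hV : IsVolterra T β V) {B : ℝ → Y →L[ℝ] Y} (hB : ContinuousOn B (Icc 0 T)) :
    IsVolterra T β fun u t => B t (V u t) where
  continuousOn u hu := hB.clm_apply (hV.continuousOn u hu)
  map_sub u v hu hv t ht := by rw [hV.map_sub u v hu hv t ht, _root_.map_sub]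
  bound := by
    obtain ⟨C, hC, h⟩ := hV.bound
    obtain ⟨b, hb, h'⟩ := exists_norm_le_of_continuousOn hB
    refine ⟨b * C, by positivity, fun μ hμ u N hu hN hu' t ht => ?_⟩
    calc ‖B t (V u t)‖ ≤ b * (C * μ ^ (-β) * N * t ^ β * Real.exp (μ * t)) :=
          (B t).le_of_opNorm_le_of_le (h' t ht) (h μ hμ u N hu hN hu' t ht)
      _ = _ := by ring

lemma comp_clm_apply (hV : IsVolterra T β V) {B : ℝ → Y →L[ℝ] Y}
    (hB : ContinuousOn B (Icc 0 T)) : IsVolterra T β fun u t => V (fun s => B s (u s)) t where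
  continuousOn u hu := hV.continuousOn _ (hB.clm_apply hu)
  map_sub u v hu hv t ht := by
    rw [← hV.map_sub _ _ (hB.clm_apply hu) (hB.clm_apply hv) t ht]
    congr 1
    ext s
    exact _root_.map_sub (B s) (u s) (v s)
  bound := by
    obtain ⟨C, hC, h⟩ := hV.bound
    obtain ⟨b, hb, h'⟩ := exists_norm_le_of_continuousOn hB
    refine ⟨C * b, by positivity, fun μ hμ u N hu hN hu' t ht => ?_⟩
    refine (h μ hμ _ (b * N) (hB.clm_apply hu) (by positivity) (fun s hs => ?_) t ht).trans_eq
      (by ring)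
    rw [mul_assoc]
    exact (B s).le_of_opNorm_le_of_le (h' s hs) (hu' s hs)

lemma comp (hβ : 0 ≤ β) (hV : IsVolterra T β V) (hW : IsVolterra T β W) :
    IsVolterra T β fun u => V (W u) where
  continuousOn u hu := hV.continuousOn _ (hW.continuousOn u hu)
  map_sub u v hu hv t ht := by
    have hWu := hW.continuousOn u hu
    have hWv := hW.continuousOn v hv
    have hWs := hW.continuousOn _ (hu.sub hv)
    rw [← hV.map_sub _ _ hWu hWv t ht]
    -- `W (u - v)` and `W u - W v` are known to agree only on [0,T]. The bound of V with N = 0 shows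
    -- that V sees nothing outside that interval.
    obtain ⟨C, hC, h⟩ := hV.bound
    have := h 1 le_rfl _ 0 (hWs.sub (hWu.sub hWv)) le_rfl (fun s hs => by
      simp only [Pi.sub_apply, hW.map_sub u v hu hv s hs]; simp) t ht
    rw [hV.map_sub _ _ hWs (hWu.sub hWv) t ht] at this
    simp only [mul_zero, zero_mul] at this
    exact sub_eq_zero.1 (norm_le_zero_iff.1 this)
  bound := by
    obtain ⟨C, hC, h⟩ := hV.bound
    obtain ⟨D, hD, h'⟩ := hW.bound
    refine ⟨C * (D * |T| ^ β), by positivity, fun μ hμ u N hu hN hu' t ht => ?_⟩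
    have hμ0 : 0 < μ := by linarith
    refine (h μ hμ _ (D * |T| ^ β * N) (hW.continuousOn u hu) (by positivity)
      (fun s hs => ?_) t ht).trans_eq (by ring)
    refine (h' μ hμ u N hu hN hu' s hs).trans ?_
    have h1 : μ ^ (-β) ≤ 1 := Real.rpow_le_one_of_one_le_of_nonpos hμ (by linarith)
    have h2 : s ^ β ≤ |T| ^ β := Real.rpow_le_rpow hs.1 (hs.2.trans (le_abs_self T)) hβ
    have hs0 := hs.1
    calc D * μ ^ (-β) * N * s ^ β * Real.exp (μ * s)
        ≤ D * 1 * N * |T| ^ β * Real.exp (μ * s) := by gcongr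
      _ = _ := by ring

end IsVolterra

end volterra

/-! ### Primitives and fractional integrals -/

section primitive

variable {Y : Type*} [NormedAddCommGroup Y] [NormedSpace ℝ Y]

lemma intervalIntegrable_of_norm_le_rpow {T A β : ℝ} (hβ : -1 < β) {g : ℝ → Y}
    (hg : ContinuousOn g (Ioc 0 T)) (hb : ∀ t ∈ Ioc 0 T, ‖g t‖ ≤ A * t ^ β) {t : ℝ}
    (ht : t ∈ Icc 0 T) : IntervalIntegrable g volume 0 t := by
  have hsub : Ioc 0 t ⊆ Ioc 0 T := Ioc_subset_Ioc_right ht.2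
  refine ((intervalIntegral.intervalIntegrable_rpow' hβ).const_mul A).mono_fun' ?_ ?_
  · rw [uIoc_of_le ht.1]
    exact (hg.mono hsub).aestronglyMeasurable measurableSet_Ioc
  · rw [uIoc_of_le ht.1]
    filter_upwards [ae_restrict_mem measurableSet_Ioc] with s hs using hb s (hsub hs)

lemma norm_primitive_le {T A β : ℝ} (hβ : -1 < β) {g : ℝ → Y}
    (hb : ∀ t ∈ Ioc 0 T, ‖g t‖ ≤ A * t ^ β) {t : ℝ} (ht : t ∈ Icc 0 T) :
    ‖∫ s in (0 : ℝ)..t, g s‖ ≤ A * (t ^ (β + 1) / (β + 1)) := by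
  refine (intervalIntegral.norm_integral_le_of_norm_le ht.1
    (ae_of_all _ fun s hs => hb s ⟨hs.1, hs.2.trans ht.2⟩)
    ((intervalIntegral.intervalIntegrable_rpow' hβ).const_mul A)).trans_eq ?_
  rw [intervalIntegral.integral_const_mul, integral_rpow (Or.inl hβ),
    Real.zero_rpow (by linarith), sub_zero]

lemma continuousOn_primitive_of_norm_le_rpow {T A β : ℝ} (hT : 0 ≤ T) (hβ : -1 < β) {g : ℝ → Y}
    (hg : ContinuousOn g (Ioc 0 T)) (hb : ∀ t ∈ Ioc 0 T, ‖g t‖ ≤ A * t ^ β) :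
    ContinuousOn (fun t => ∫ s in (0 : ℝ)..t, g s) (Icc 0 T) := by
  have h := (intervalIntegrable_of_norm_le_rpow hβ hg hb ⟨hT, le_rfl⟩)
  rw [intervalIntegrable_iff'] at h
  have := intervalIntegral.continuousOn_primitive_interval h
  rwa [uIcc_of_le hT] at this

lemma hasDerivWithinAt_primitive [CompleteSpace Y] {T A β : ℝ} (hβ : -1 < β) {g : ℝ → Y}
    (hg : ContinuousOn g (Ioc 0 T)) (hb : ∀ t ∈ Ioc 0 T, ‖g t‖ ≤ A * t ^ β) {t : ℝ}
    (ht : t ∈ Ioc 0 T) :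
    HasDerivWithinAt (fun t => ∫ s in (0 : ℝ)..t, g s) (g t) (Ioc 0 T) t := by
  have hT : 0 < T := ht.1.trans_le ht.2
  -- Freezing g beyond T makes the integrand continuous on both sides of the endpoint t = T, so the
  -- two-sided fundamental theorem applies there too.
  set G : ℝ → Y := fun s => g (min s T) with hG
  have hGc : ContinuousOn G (Ioi 0) := hg.comp (by fun_prop) fun s hs =>
    ⟨lt_min hs hT, min_le_right _ _⟩
  have heq : ∀ s ∈ Icc 0 T, ∫ z in (0 : ℝ)..s, G z = ∫ z in (0 : ℝ)..s, g z := by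
    intro s hs
    refine intervalIntegral.integral_congr fun z hz => ?_
    rw [uIcc_of_le hs.1] at hz
    simp only [hG]
    rw [min_eq_left (hz.2.trans hs.2)]
  have hint : IntervalIntegrable G volume 0 t := by
    refine (intervalIntegrable_of_norm_le_rpow hβ hg hb ⟨ht.1.le, ht.2⟩).congr fun z hz => ?_
    rw [uIoc_of_le ht.1.le] at hz
    simp only [hG]
    rw [min_eq_left (hz.2.trans ht.2)]
  have h := intervalIntegral.integral_hasDerivAt_right hint
    (hGc.stronglyMeasurableAtFilter isOpen_Ioi t ht.1) (hGc.continuousAt (Ioi_mem_nhds ht.1))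
  have hGt : G t = g t := by simp only [hG]; rw [min_eq_left ht.2]
  rw [hGt] at h
  exact h.hasDerivWithinAt.congr (fun s hs => (heq s ⟨hs.1.le, hs.2⟩).symm)
    (heq t ⟨ht.1.le, ht.2⟩).symm

lemma primitive_of_hasDerivWithinAt [CompleteSpace Y] {T A β : ℝ} (hβ : -1 < β) {f g : ℝ → Y}
    (hf : ContinuousOn f (Icc 0 T)) (hg : ContinuousOn g (Ioc 0 T))
    (hb : ∀ t ∈ Ioc 0 T, ‖g t‖ ≤ A * t ^ β)
    (h : ∀ t ∈ Ioc 0 T, HasDerivWithinAt f (g t) (Ioc 0 T) t) {t : ℝ} (ht : t ∈ Icc 0 T) :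
    ∫ s in (0 : ℝ)..t, g s = f t - f 0 :=
  intervalIntegral.integral_eq_sub_of_hasDerivAt_of_le ht.1 (hf.mono (Icc_subset_Icc_right ht.2))
    (fun s hs => (h s ⟨hs.1, hs.2.le.trans ht.2⟩).hasDerivAt
      (Ioc_mem_nhds hs.1 (hs.2.trans_le ht.2)))
    (intervalIntegrable_of_norm_le_rpow hβ hg hb ht)

end primitive

/-! ### Fractional integrals in dilation form -/

section frac

variable {Y : Type*} [NormedAddCommGroup Y] [NormedSpace ℝ Y]

/-- The weighted average `∫₀¹ ω_γ(1-σ) u(tσ) dσ`. -/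
def fracMean (γ : ℝ) (u : ℝ → Y) (t : ℝ) : Y :=
  ∫ σ in (0 : ℝ)..1, omega γ (1 - σ) • u (t * σ)

/-- The fractional integral of order `γ`, in the scaled form `t^γ ∫₀¹ ω_γ(1-σ) u(tσ) dσ`. -/
def frac (γ : ℝ) (u : ℝ → Y) (t : ℝ) : Y := t ^ γ • fracMean γ u t

lemma measurable_omega (γ : ℝ) : Measurable (omega γ) := by
  unfold omega; fun_prop

lemma omega_nonneg {γ t : ℝ} (hγ : 0 < γ) (ht : 0 ≤ t) : 0 ≤ omega γ t :=
  div_nonneg (Real.rpow_nonneg ht _) (Real.Gamma_pos_of_pos hγ).le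

lemma intervalIntegrable_one_sub_rpow {p : ℝ} (hp : -1 < p) :
    IntervalIntegrable (fun σ : ℝ => (1 - σ) ^ p) volume 0 1 := by
  have := (intervalIntegral.intervalIntegrable_rpow' (a := 0) (b := 1) hp).comp_sub_left 1
  simpa using this.symm

lemma intervalIntegrable_omega_one_sub {γ : ℝ} (hγ : 0 < γ) :
    IntervalIntegrable (fun σ => omega γ (1 - σ)) volume 0 1 :=
  (intervalIntegrable_one_sub_rpow (by linarith : -1 < γ - 1)).div_const _

lemma mul_mem_Icc {T t σ : ℝ} (ht : t ∈ Icc 0 T) (hσ : σ ∈ Icc (0 : ℝ) 1) : t * σ ∈ Icc 0 T :=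
  ⟨mul_nonneg ht.1 hσ.1, (mul_le_of_le_one_right ht.1 hσ.2).trans ht.2⟩

lemma mul_mem_Ioc {T t σ : ℝ} (ht : t ∈ Ioc 0 T) (hσ : σ ∈ Ioc (0 : ℝ) 1) : t * σ ∈ Ioc 0 T :=
  ⟨mul_pos ht.1 hσ.1, (mul_le_of_le_one_right ht.1.le hσ.2).trans ht.2⟩

variable {T γ : ℝ} {u : ℝ → Y}

lemma aestronglyMeasurable_fracMean_integrand (hu : ContinuousOn u (Icc 0 T)) {t : ℝ}
    (ht : t ∈ Icc 0 T) :
    AEStronglyMeasurable (fun σ => omega γ (1 - σ) • u (t * σ))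
      (volume.restrict (uIoc (0 : ℝ) 1)) := by
  rw [uIoc_of_le zero_le_one]
  have h1 : ContinuousOn (fun σ => u (t * σ)) (Ioc 0 1) :=
    hu.comp (by fun_prop) fun σ hσ => mul_mem_Icc ht ⟨hσ.1.le, hσ.2⟩
  exact ((measurable_omega γ).comp (measurable_const.sub measurable_id)).aestronglyMeasurable.smul
    (h1.aestronglyMeasurable measurableSet_Ioc)

lemma intervalIntegrable_fracMean_integrand (hγ : 0 < γ) (hu : ContinuousOn u (Icc 0 T)) {t : ℝ}
    (ht : t ∈ Icc 0 T) :
    IntervalIntegrable (fun σ => omega γ (1 - σ) • u (t * σ)) volume 0 1 := by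
  obtain ⟨b, -, hb⟩ := exists_norm_le_of_continuousOn hu
  refine ((intervalIntegrable_omega_one_sub hγ).mul_const b).mono_fun'
    (aestronglyMeasurable_fracMean_integrand hu ht) ?_
  rw [uIoc_of_le zero_le_one]
  filter_upwards [ae_restrict_mem measurableSet_Ioc] with σ hσ
  have h0 := omega_nonneg hγ (sub_nonneg.2 hσ.2)
  rw [norm_smul, Real.norm_of_nonneg h0]
  gcongr
  exact hb _ (mul_mem_Icc ht ⟨hσ.1.le, hσ.2⟩)

lemma norm_fracMean_le (hγ : 0 < γ) {A t : ℝ} (ht : t ∈ Icc 0 T)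
    (hA : ∀ s ∈ Icc 0 T, ‖u s‖ ≤ A) :
    ‖fracMean γ u t‖ ≤ (∫ σ in (0 : ℝ)..1, omega γ (1 - σ)) * A := by
  rw [← intervalIntegral.integral_mul_const]
  refine intervalIntegral.norm_integral_le_of_norm_le zero_le_one (ae_of_all _ fun σ hσ => ?_)
    ((intervalIntegrable_omega_one_sub hγ).mul_const A)
  have h0 := omega_nonneg hγ (sub_nonneg.2 hσ.2)
  rw [norm_smul, Real.norm_of_nonneg h0]
  gcongr
  exact hA _ (mul_mem_Icc ht ⟨hσ.1.le, hσ.2⟩)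

lemma integral_omega_one_sub_nonneg (hγ : 0 < γ) : 0 ≤ ∫ σ in (0 : ℝ)..1, omega γ (1 - σ) :=
  intervalIntegral.integral_nonneg zero_le_one fun _ hσ => omega_nonneg hγ (sub_nonneg.2 hσ.2)

lemma continuousOn_fracMean (hγ : 0 < γ) (hu : ContinuousOn u (Icc 0 T)) :
    ContinuousOn (fracMean γ u) (Icc 0 T) := by
  obtain ⟨b, -, hb⟩ := exists_norm_le_of_continuousOn hu
  intro t ht
  refine intervalIntegral.continuousWithinAt_of_dominated_interval
    (bound := fun σ => omega γ (1 - σ) * b) ?_ ?_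
    ((intervalIntegrable_omega_one_sub hγ).mul_const b) ?_
  · filter_upwards [self_mem_nhdsWithin] with y hy
    exact aestronglyMeasurable_fracMean_integrand hu hy
  · filter_upwards [self_mem_nhdsWithin] with y hy
    refine ae_of_all _ fun σ hσ => ?_
    rw [uIoc_of_le zero_le_one] at hσ
    have h0 := omega_nonneg hγ (sub_nonneg.2 hσ.2)
    rw [norm_smul, Real.norm_of_nonneg h0]
    gcongr
    exact hb _ (mul_mem_Icc hy ⟨hσ.1.le, hσ.2⟩)
  · refine ae_of_all _ fun σ hσ => ?_
    rw [uIoc_of_le zero_le_one] at hσ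
    exact ((hu.comp (by fun_prop : ContinuousOn (fun y => y * σ) (Icc 0 T)) fun y hy =>
      mul_mem_Icc hy ⟨hσ.1.le, hσ.2⟩).const_smul (omega γ (1 - σ))) t ht

lemma continuousOn_frac (hγ : 0 < γ) (hu : ContinuousOn u (Icc 0 T)) :
    ContinuousOn (frac γ u) (Icc 0 T) :=
  ((Real.continuous_rpow_const hγ.le).continuousOn).smul (continuousOn_fracMean hγ hu)

lemma norm_frac_le (hγ : 0 < γ) {A t : ℝ} (ht : t ∈ Icc 0 T) (hA : ∀ s ∈ Icc 0 T, ‖u s‖ ≤ A) :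
    ‖frac γ u t‖ ≤ (∫ σ in (0 : ℝ)..1, omega γ (1 - σ)) * A * t ^ γ := by
  have h0 := Real.rpow_nonneg ht.1 γ
  rw [frac, norm_smul, Real.norm_of_nonneg h0, mul_comm]
  exact mul_le_mul_of_nonneg_right (norm_fracMean_le hγ ht hA) h0

/-- The fractional integral in convolution form. -/
lemma frac_eq_integral (hγ : 0 < γ) {t : ℝ} (ht : 0 ≤ t) :
    frac γ u t = ∫ s in (0 : ℝ)..t, omega γ (t - s) • u s := by
  rcases ht.eq_or_lt with rfl | ht
  · simp [frac, Real.zero_rpow hγ.ne']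
  have h := intervalIntegral.smul_integral_comp_mul_left (a := 0) (b := 1)
    (fun s => omega γ (t - s) • u s) t
  rw [mul_zero, mul_one] at h
  rw [← h, frac, fracMean, ← intervalIntegral.integral_smul, ← intervalIntegral.integral_smul]
  refine intervalIntegral.integral_congr fun σ hσ => ?_
  rw [uIcc_of_le zero_le_one] at hσ
  simp only [smul_smul]
  congr 1
  rw [omega, omega, show t - t * σ = t * (1 - σ) by ring,
    Real.mul_rpow ht.le (sub_nonneg.2 hσ.2), Real.rpow_sub_one ht.ne']
  field_simp

lemma frac_one {t : ℝ} (ht : 0 ≤ t) : frac 1 u t = ∫ s in (0 : ℝ)..t, u s := by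
  rw [frac_eq_integral one_pos ht]
  simp [omega]

/-- The dilation-invariant derivative `t d/dt` commutes with `fracMean`. -/
lemma hasDerivWithinAt_fracMean (hγ : 0 < γ) {w : ℝ → Y} (hu : ContinuousOn u (Icc 0 T))
    (hw : ContinuousOn w (Icc 0 T))
    (h : ∀ t ∈ Ioc 0 T, HasDerivWithinAt u (t⁻¹ • w t) (Ioc 0 T) t) {t : ℝ} (ht : t ∈ Ioc 0 T) :
    HasDerivWithinAt (fracMean γ u) (t⁻¹ • fracMean γ w t) (Ioc 0 T) t := by
  obtain ⟨b, hb0, hb⟩ := exists_norm_le_of_continuousOn hw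
  have ht' : t ∈ Icc 0 T := ⟨ht.1.le, ht.2⟩
  rw [hasDerivWithinAt_iff_tendsto_slope]
  have hmem : ∀ᶠ y in 𝓝[Ioc 0 T \ {t}] t, y ∈ Ioc 0 T ∧ y ≠ t ∧ t / 2 < y := by
    filter_upwards [self_mem_nhdsWithin,
      mem_nhdsWithin_of_mem_nhds (Ioi_mem_nhds (half_lt_self ht.1))] with y hy hy'
    exact ⟨hy.1, hy.2, hy'⟩
  have key : Tendsto (fun y => ∫ σ in (0 : ℝ)..1,
      (y - t)⁻¹ • (omega γ (1 - σ) • u (y * σ) - omega γ (1 - σ) • u (t * σ)))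
      (𝓝[Ioc 0 T \ {t}] t)
      (𝓝 (∫ σ in (0 : ℝ)..1, t⁻¹ • (omega γ (1 - σ) • w (t * σ)))) := by
    refine intervalIntegral.tendsto_integral_filter_of_dominated_convergence
      (fun σ => omega γ (1 - σ) * (2 * b / t)) ?_ ?_
      ((intervalIntegrable_omega_one_sub hγ).mul_const _) ?_
    · filter_upwards [hmem] with y hy
      exact ((aestronglyMeasurable_fracMean_integrand hu ⟨hy.1.1.le, hy.1.2⟩).sub
        (aestronglyMeasurable_fracMean_integrand hu ht')).const_smul _
    · filter_upwards [hmem] with y hy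
      refine ae_of_all _ fun σ hσ => ?_
      rw [uIoc_of_le zero_le_one] at hσ
      have h0 := omega_nonneg hγ (sub_nonneg.2 hσ.2)
      have ht2 : 0 < t / 2 * σ := mul_pos (half_pos ht.1) hσ.1
      have hsub : Icc (t / 2 * σ) T ⊆ Ioc 0 T := fun s hs => ⟨ht2.trans_le hs.1, hs.2⟩
      -- On `[tσ/2, T]` the derivative `s⁻¹ w(s)` is at most `2b/(tσ)`. The increment `(y-t)σ`
      -- cancels the singular `1/σ`, leaving a dominating function independent of y.
      have hmv := Convex.norm_image_sub_le_of_norm_hasDerivWithin_le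
        (f := u) (f' := fun s => s⁻¹ • w s) (s := Icc (t / 2 * σ) T) (C := (t / 2 * σ)⁻¹ * b)
        (x := t * σ) (y := y * σ) (fun s hs => (h s (hsub hs)).mono hsub)
        (fun s hs => by
          have hs' := hsub hs
          rw [norm_smul, norm_inv, Real.norm_of_nonneg hs'.1.le]
          have := hs.1
          gcongr
          exact hb s ⟨hs'.1.le, hs'.2⟩)
        (convex_Icc _ _)
        ⟨mul_le_mul_of_nonneg_right (half_le_self ht.1.le) hσ.1.le, (mul_mem_Ioc ht hσ).2⟩
        ⟨mul_le_mul_of_nonneg_right hy.2.2.le hσ.1.le, (mul_mem_Ioc hy.1 hσ).2⟩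
      rw [← smul_sub, norm_smul, norm_smul, norm_inv, Real.norm_of_nonneg h0]
      have hne : 0 < ‖y - t‖ := norm_pos_iff.2 (sub_ne_zero.2 hy.2.1)
      calc ‖y - t‖⁻¹ * (omega γ (1 - σ) * ‖u (y * σ) - u (t * σ)‖)
          ≤ ‖y - t‖⁻¹ * (omega γ (1 - σ) * ((t / 2 * σ)⁻¹ * b * ‖y * σ - t * σ‖)) := by gcongr
        _ = omega γ (1 - σ) * (2 * b / t) := by
          rw [← sub_mul, norm_mul, Real.norm_of_nonneg hσ.1.le]
          have := hσ.1.ne'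
          have := ht.1.ne'
          field_simp
    · refine ae_of_all _ fun σ hσ => ?_
      rw [uIoc_of_le zero_le_one] at hσ
      have hd := (h (t * σ) (mul_mem_Ioc ht hσ)).scomp t
        (((hasDerivAt_id t).mul_const σ).hasDerivWithinAt (s := Ioc 0 T))
        (fun y hy => mul_mem_Ioc hy hσ)
      have hd2 := hasDerivWithinAt_iff_tendsto_slope.1 (hd.const_smul (omega γ (1 - σ)))
      have hval : omega γ (1 - σ) • (1 * σ) • (t * σ)⁻¹ • w (t * σ)
          = t⁻¹ • (omega γ (1 - σ) • w (t * σ)) := by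
        simp only [smul_smul]
        congr 1
        have := hσ.1.ne'
        have := ht.1.ne'
        field_simp
      rw [hval] at hd2
      exact hd2
  have hval : ∫ σ in (0 : ℝ)..1, t⁻¹ • (omega γ (1 - σ) • w (t * σ)) = t⁻¹ • fracMean γ w t :=
    intervalIntegral.integral_smul _ _
  rw [hval] at key
  refine key.congr' ?_
  filter_upwards [hmem] with y hy
  rw [intervalIntegral.integral_smul, intervalIntegral.integral_sub
    (intervalIntegrable_fracMean_integrand hγ hu ⟨hy.1.1.le, hy.1.2⟩)
    (intervalIntegrable_fracMean_integrand hγ hu ht')]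
  rfl

/-- Product rule for `t^γ` times the dilation average: with `w = t u'`, the field `t d/dt` maps `I^γ
u` to `γ I^γ u + I^γ w`. -/
lemma hasDerivWithinAt_frac (hγ : 0 < γ) {w : ℝ → Y} (hu : ContinuousOn u (Icc 0 T))
    (hw : ContinuousOn w (Icc 0 T))
    (h : ∀ t ∈ Ioc 0 T, HasDerivWithinAt u (t⁻¹ • w t) (Ioc 0 T) t) {t : ℝ} (ht : t ∈ Ioc 0 T) :
    HasDerivWithinAt (frac γ u) (t⁻¹ • (γ • frac γ u t + frac γ w t)) (Ioc 0 T) t := by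
  have h1 := (Real.hasDerivAt_rpow_const (p := γ) (Or.inl ht.1.ne')).hasDerivWithinAt.smul
    (hasDerivWithinAt_fracMean hγ hu hw h ht)
  refine h1.congr_deriv ?_
  rw [frac, frac, Real.rpow_sub_one ht.1.ne', smul_add, add_comm]
  simp only [smul_smul]
  congr 2 <;> ring

/-- `e^x ≥ 1 + x ≥ x^p` for exponents in [0,1]. This trades exponential decay for a negative power
of the weight parameter. -/
lemma exp_neg_le_rpow_neg {x p : ℝ} (hx : 0 < x) (h0 : 0 ≤ p) (h1 : p ≤ 1) :
    Real.exp (-x) ≤ x ^ (-p) := by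
  rw [Real.rpow_neg hx.le, Real.exp_neg]
  gcongr
  have : x ^ p ≤ 1 + x := by
    rcases le_total x 1 with h | h
    · linarith [Real.rpow_le_one hx.le h h0]
    · calc x ^ p ≤ x ^ (1 : ℝ) := Real.rpow_le_rpow_of_exponent_le h h1
        _ ≤ 1 + x := by simp
  linarith [Real.add_one_le_exp x]

lemma fracMean_sub (hγ : 0 < γ) {v : ℝ → Y} (hu : ContinuousOn u (Icc 0 T))
    (hv : ContinuousOn v (Icc 0 T)) {t : ℝ} (ht : t ∈ Icc 0 T) :
    fracMean γ (u - v) t = fracMean γ u t - fracMean γ v t := by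
  rw [fracMean, fracMean, fracMean, ← intervalIntegral.integral_sub
    (intervalIntegrable_fracMean_integrand hγ hu ht)
    (intervalIntegrable_fracMean_integrand hγ hv ht)]
  simp only [Pi.sub_apply, smul_sub]

/-- Fractional integration is a Volterra operator. -/
lemma isVolterra_frac {β : ℝ} (hβ : 0 < β) (hβ1 : β ≤ 1) (hγ : 2 * β ≤ γ) :
    IsVolterra T β (frac γ : (ℝ → Y) → ℝ → Y) where
  continuousOn u hu := continuousOn_frac (by linarith) hu
  map_sub u v hu hv t ht := by
    rw [frac, fracMean_sub (by linarith) hu hv ht, smul_sub]; rfl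
  bound := by
    have hγ0 : 0 < γ := by linarith
    -- The extra `(1-σ)^(-β)` comes from `e^(-μt(1-σ)) ≤ (μt(1-σ))^(-β)`. It is integrable against
    -- `ω_γ(1-σ)` because β < γ. The same estimate costs `t^(-β)`, and `2β ≤ γ` leaves `t^β` times a
    -- nonnegative power of t.
    set I := ∫ σ in (0 : ℝ)..1, omega γ (1 - σ) * (1 - σ) ^ (-β)
    have hint : IntervalIntegrable (fun σ : ℝ => omega γ (1 - σ) * (1 - σ) ^ (-β)) volume 0 1 := by
      refine ((intervalIntegrable_one_sub_rpow (p := γ - 1 - β) (by linarith)).div_const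
        (Real.Gamma γ)).congr_ae ?_
      rw [uIoc_of_le zero_le_one, ← restrict_Ioo_eq_restrict_Ioc]
      filter_upwards [ae_restrict_mem measurableSet_Ioo] with σ hσ
      rw [omega, div_mul_eq_mul_div, ← Real.rpow_add (sub_pos.2 hσ.2), ← sub_eq_add_neg]
    have hI : 0 ≤ I := intervalIntegral.integral_nonneg zero_le_one fun σ hσ =>
      mul_nonneg (omega_nonneg hγ0 (sub_nonneg.2 hσ.2)) (Real.rpow_nonneg (sub_nonneg.2 hσ.2) _)
    refine ⟨I * |T| ^ (γ - 2 * β), by positivity, fun μ hμ u N hu hN hb t ht => ?_⟩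
    have hμ0 : 0 < μ := by linarith
    rcases ht.1.eq_or_lt with rfl | ht0
    · simp [frac, Real.zero_rpow hγ0.ne', Real.zero_rpow hβ.ne']
    have h1 : ‖fracMean γ u t‖ ≤ I * ((μ * t) ^ (-β) * N * Real.exp (μ * t)) := by
      rw [← intervalIntegral.integral_mul_const]
      refine intervalIntegral.norm_integral_le_of_norm_le zero_le_one ?_ (hint.mul_const _)
      have hne : ∀ᵐ σ : ℝ, σ ≠ 1 := by simp [ae_iff]
      filter_upwards [hne] with σ hσ1 hσ
      have hσ' : 0 < 1 - σ := sub_pos.2 (lt_of_le_of_ne hσ.2 hσ1)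
      have h0 := omega_nonneg hγ0 hσ'.le
      rw [norm_smul, Real.norm_of_nonneg h0, mul_assoc]
      refine mul_le_mul_of_nonneg_left ?_ h0
      calc ‖u (t * σ)‖ ≤ N * Real.exp (μ * (t * σ)) := hb _ (mul_mem_Icc ht ⟨hσ.1.le, hσ.2⟩)
        _ = N * Real.exp (μ * t) * Real.exp (-(μ * t * (1 - σ))) := by
            rw [mul_assoc, ← Real.exp_add]; ring_nf
        _ ≤ N * Real.exp (μ * t) * (μ * t * (1 - σ)) ^ (-β) := by
            gcongr
            exact exp_neg_le_rpow_neg (by positivity) hβ.le hβ1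
        _ = _ := by rw [Real.mul_rpow (by positivity) hσ'.le]; ring
    rw [frac, norm_smul, Real.norm_of_nonneg (Real.rpow_nonneg ht.1 _)]
    have h2 : t ^ γ * t ^ (-β) = t ^ (γ - 2 * β) * t ^ β := by
      rw [← Real.rpow_add ht0, ← Real.rpow_add ht0]; ring_nf
    have h3 : t ^ (γ - 2 * β) ≤ |T| ^ (γ - 2 * β) :=
      Real.rpow_le_rpow ht.1 (ht.2.trans (le_abs_self T)) (by linarith)
    calc t ^ γ * ‖fracMean γ u t‖
        ≤ t ^ γ * (I * ((μ * t) ^ (-β) * N * Real.exp (μ * t))) := by gcongr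
      _ = t ^ (γ - 2 * β) * (I * μ ^ (-β) * N * t ^ β * Real.exp (μ * t)) := by
          rw [Real.mul_rpow hμ0.le ht.1]
          calc _ = (t ^ γ * t ^ (-β)) * (I * μ ^ (-β) * N * Real.exp (μ * t)) := by ring
            _ = _ := by rw [h2]; ring
      _ ≤ |T| ^ (γ - 2 * β) * (I * μ ^ (-β) * N * t ^ β * Real.exp (μ * t)) := by gcongr
      _ = _ := by ring

/-- The integral with weight `s⁻¹` of a Volterra operator is a Volterra operator. -/
lemma IsVolterra.integral_inv_smul {T β : ℝ} (hT : 0 ≤ T) (hβ : 0 < β) {V : (ℝ → Y) → ℝ → Y}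
    (hV : IsVolterra T β V) : IsVolterra T β fun u t => ∫ s in (0 : ℝ)..t, s⁻¹ • V u s := by
  obtain ⟨C, hC, h⟩ := hV.bound
  have hcont : ∀ u, ContinuousOn u (Icc 0 T) →
      ContinuousOn (fun s => s⁻¹ • V u s) (Ioc 0 T) := fun u hu =>
    (continuousOn_id.inv₀ fun s hs => hs.1.ne').smul
      ((hV.continuousOn u hu).mono Ioc_subset_Icc_self)
  -- The exponential is replaced by its value at the upper limit t, so only `∫ s^(β-1) = t^β/β`
  -- remains, whence the constant `C / β`.
  have hbd : ∀ μ, 1 ≤ μ → ∀ u N, ContinuousOn u (Icc 0 T) → 0 ≤ N →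
      (∀ s ∈ Icc 0 T, ‖u s‖ ≤ N * Real.exp (μ * s)) → ∀ t ∈ Icc 0 T,
      ∀ s ∈ Ioc 0 t, ‖s⁻¹ • V u s‖ ≤ C * μ ^ (-β) * N * Real.exp (μ * t) * s ^ (β - 1) := by
    intro μ hμ u N hu hN hb t ht s hs
    have hμ0 : 0 < μ := by linarith
    have hs0 := hs.1
    have hst := hs.2
    rw [norm_smul, norm_inv, Real.norm_of_nonneg hs0.le, Real.rpow_sub_one hs0.ne']
    calc s⁻¹ * ‖V u s‖ ≤ s⁻¹ * (C * μ ^ (-β) * N * s ^ β * Real.exp (μ * s)) := by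
          gcongr
          exact h μ hμ u N hu hN hb s ⟨hs0.le, hst.trans ht.2⟩
      _ ≤ s⁻¹ * (C * μ ^ (-β) * N * s ^ β * Real.exp (μ * t)) := by gcongr
      _ = _ := by ring
  have hbd' : ∀ u, ContinuousOn u (Icc 0 T) → ∃ A, ∀ s ∈ Ioc 0 T,
      ‖s⁻¹ • V u s‖ ≤ A * s ^ (β - 1) := by
    intro u hu
    obtain ⟨b, hb0, hb⟩ := exists_norm_le_of_continuousOn hu
    refine ⟨_, hbd 1 le_rfl u b hu hb0 (fun s hs => (hb s hs).trans ?_) T ⟨hT, le_rfl⟩⟩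
    exact le_mul_of_one_le_right hb0 (Real.one_le_exp (by simpa using hs.1))
  refine ⟨fun u hu => ?_, fun u v hu hv t ht => ?_, C / β, by positivity,
    fun μ hμ u N hu hN hb t ht => ?_⟩
  · obtain ⟨A, hA⟩ := hbd' u hu
    exact continuousOn_primitive_of_norm_le_rpow hT (by linarith) (hcont u hu) hA
  · obtain ⟨A, hA⟩ := hbd' u hu
    obtain ⟨A', hA'⟩ := hbd' v hv
    rw [← intervalIntegral.integral_sub
      (intervalIntegrable_of_norm_le_rpow (by linarith) (hcont u hu) hA ht)
      (intervalIntegrable_of_norm_le_rpow (by linarith) (hcont v hv) hA' ht)]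
    refine intervalIntegral.integral_congr fun s hs => ?_
    rw [uIcc_of_le ht.1] at hs
    simp only [hV.map_sub u v hu hv s ⟨hs.1, hs.2.trans ht.2⟩, smul_sub]
  · refine (norm_primitive_le (T := t) (by linarith) (hbd μ hμ u N hu hN hb t ht)
      ⟨ht.1, le_rfl⟩).trans_eq ?_
    rw [sub_add_cancel]; ring

end frac

/-! ### Weighted bounds on derivatives -/

section derivBound

variable {Y Z W : Type*} [NormedAddCommGroup Y] [NormedSpace ℝ Y] [NormedAddCommGroup Z]
  [NormedSpace ℝ Z] [NormedAddCommGroup W] [NormedSpace ℝ W]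

/-- `v` is `C^k` on `(0,T]` and `‖v^{(j)}(t)‖ ≤ A t^(β-j)` for `j ≤ k`. -/
def DerivBound (T : ℝ) : ℕ → ℝ → (ℝ → Y) → ℝ → Prop
  | 0, β, v, A => ContinuousOn v (Ioc 0 T) ∧ ∀ t ∈ Ioc 0 T, ‖v t‖ ≤ A * t ^ β
  | k + 1, β, v, A => (∀ t ∈ Ioc 0 T, ‖v t‖ ≤ A * t ^ β) ∧
      ∃ v' : ℝ → Y, (∀ t ∈ Ioc 0 T, HasDerivWithinAt v (v' t) (Ioc 0 T) t) ∧
        DerivBound T k (β - 1) v' A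

namespace DerivBound

variable {T β : ℝ} {k : ℕ} {v : ℝ → Y} {A : ℝ}

lemma bound (h : DerivBound T k β v A) : ∀ t ∈ Ioc 0 T, ‖v t‖ ≤ A * t ^ β := by
  cases k with
  | zero => exact h.2
  | succ k => exact h.1

lemma continuousOn (h : DerivBound T k β v A) : ContinuousOn v (Ioc 0 T) := by
  cases k with
  | zero => exact h.1
  | succ k =>
    obtain ⟨v', hv', -⟩ := h.2
    exact fun t ht => (hv' t ht).continuousWithinAt

lemma nonneg (hT : 0 < T) (h : DerivBound T k β v A) : 0 ≤ A :=
  nonneg_of_mul_nonneg_left ((norm_nonneg _).trans (h.bound T ⟨hT, le_rfl⟩))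
    (Real.rpow_pos_of_pos hT β)

lemma mono {A' : ℝ} (h : DerivBound T k β v A) (hA : A ≤ A') : DerivBound T k β v A' := by
  have key : ∀ t ∈ Ioc 0 T, ‖v t‖ ≤ A' * t ^ β := fun t ht =>
    (h.bound t ht).trans (mul_le_mul_of_nonneg_right hA (Real.rpow_nonneg ht.1.le _))
  induction k generalizing β v with
  | zero => exact ⟨h.1, key⟩
  | succ k ih =>
    obtain ⟨-, v', h1, h2⟩ := h
    exact ⟨key, v', h1, ih h2 fun t ht =>
      (h2.bound t ht).trans (mul_le_mul_of_nonneg_right hA (Real.rpow_nonneg ht.1.le _))⟩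

lemma of_succ (h : DerivBound T (k + 1) β v A) : DerivBound T k β v A := by
  induction k generalizing β v with
  | zero => exact ⟨h.continuousOn, h.bound⟩
  | succ k ih =>
    obtain ⟨h0, v', h1, h2⟩ := h
    exact ⟨h0, v', h1, ih h2⟩

lemma of_le {j : ℕ} (hj : j ≤ k) (h : DerivBound T k β v A) : DerivBound T j β v A := by
  induction k, hj using Nat.le_induction with
  | base => exact h
  | succ k _ ih => exact ih h.of_succ

lemma weaken {β' : ℝ} (hA : 0 ≤ A) (hβ : β' ≤ β) (h : DerivBound T k β v A) :
    DerivBound T k β' v (A * T ^ (β - β')) := by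
  have key : ∀ (b b' : ℝ), b' ≤ b → ∀ (w : ℝ → Y), (∀ t ∈ Ioc 0 T, ‖w t‖ ≤ A * t ^ b) →
      ∀ t ∈ Ioc 0 T, ‖w t‖ ≤ A * T ^ (b - b') * t ^ b' := by
    intro b b' hb w hw t ht
    have h1 : t ^ b = t ^ (b - b') * t ^ b' := by rw [← Real.rpow_add ht.1]; ring_nf
    have h2 : t ^ (b - b') ≤ T ^ (b - b') := Real.rpow_le_rpow ht.1.le ht.2 (by linarith)
    have h3 := Real.rpow_nonneg ht.1.le b'
    refine (hw t ht).trans ?_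
    rw [h1, mul_assoc]
    gcongr
  induction k generalizing β β' v with
  | zero => exact ⟨h.1, key _ _ hβ v h.2⟩
  | succ k ih =>
    obtain ⟨h0, v', h1, h2⟩ := h
    refine ⟨key _ _ hβ v h0, v', h1, ?_⟩
    have := ih (β' := β' - 1) (by linarith) h2
    rwa [sub_sub_sub_cancel_right] at this

lemma congr {w : ℝ → Y} (h : DerivBound T k β v A) (hvw : EqOn w v (Ioc 0 T)) :
    DerivBound T k β w A := by
  have key : ∀ t ∈ Ioc 0 T, ‖w t‖ ≤ A * t ^ β := fun t ht => by
    rw [hvw ht]; exact h.bound t ht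
  cases k with
  | zero => exact ⟨h.1.congr hvw, key⟩
  | succ k =>
    obtain ⟨-, v', h1, h2⟩ := h
    exact ⟨key, v', fun t ht => (h1 t ht).congr hvw (hvw ht), h2⟩

lemma add {w : ℝ → Y} {B : ℝ} (hv : DerivBound T k β v A) (hw : DerivBound T k β w B) :
    DerivBound T k β (fun t => v t + w t) (A + B) := by
  have key : ∀ t ∈ Ioc 0 T, ‖v t + w t‖ ≤ (A + B) * t ^ β := fun t ht => by
    rw [add_mul]; exact norm_add_le_of_le (hv.bound t ht) (hw.bound t ht)
  induction k generalizing β v w with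
  | zero => exact ⟨hv.1.add hw.1, key⟩
  | succ k ih =>
    obtain ⟨-, v', h1, h2⟩ := hv
    obtain ⟨-, w', h1', h2'⟩ := hw
    refine ⟨key, fun t => v' t + w' t, fun t ht => (h1 t ht).add (h1' t ht), ih h2 h2' ?_⟩
    intro t ht
    rw [add_mul]; exact norm_add_le_of_le (h2.bound t ht) (h2'.bound t ht)

lemma clm (L : Y →L[ℝ] Z) (hv : DerivBound T k β v A) :
    DerivBound T k β (fun t => L (v t)) (‖L‖ * A) := by
  induction k generalizing β v with
  | zero =>
    exact ⟨L.continuous.comp_continuousOn hv.1, fun t ht => by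
      rw [mul_assoc]; exact L.le_opNorm_of_le (hv.2 t ht)⟩
  | succ k ih =>
    obtain ⟨h0, v', h1, h2⟩ := hv
    refine ⟨fun t ht => ?_, fun t => L (v' t),
      fun t ht => L.hasFDerivAt.comp_hasDerivWithinAt t (h1 t ht), ih h2⟩
    rw [mul_assoc]; exact L.le_opNorm_of_le (h0 t ht)

lemma neg (hv : DerivBound T k β v A) : DerivBound T k β (fun t => -v t) A := by
  induction k generalizing β v with
  | zero => exact ⟨hv.1.neg, fun t ht => by rw [norm_neg]; exact hv.2 t ht⟩
  | succ k ih =>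
    obtain ⟨h0, v', h1, h2⟩ := hv
    exact ⟨fun t ht => by rw [norm_neg]; exact h0 t ht, fun t => -v' t,
      fun t ht => (h1 t ht).neg, ih h2⟩

lemma sub {w : ℝ → Y} {B : ℝ} (hv : DerivBound T k β v A) (hw : DerivBound T k β w B) :
    DerivBound T k β (fun t => v t - w t) (A + B) := by
  simpa only [sub_eq_add_neg] using hv.add hw.neg

lemma const_smul (c : ℝ) (hv : DerivBound T k β v A) :
    DerivBound T k β (fun t => c • v t) (|c| * A) := by
  induction k generalizing β v with
  | zero =>
    exact ⟨hv.1.const_smul c, fun t ht => by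
      rw [norm_smul, mul_assoc, Real.norm_eq_abs]
      exact mul_le_mul_of_nonneg_left (hv.2 t ht) (abs_nonneg c)⟩
  | succ k ih =>
    obtain ⟨h0, v', h1, h2⟩ := hv
    refine ⟨fun t ht => ?_, fun t => c • v' t, fun t ht => (h1 t ht).const_smul c, ih h2⟩
    rw [norm_smul, mul_assoc, Real.norm_eq_abs]
    exact mul_le_mul_of_nonneg_left (h0 t ht) (abs_nonneg c)

/-- Leibniz rule. -/
lemma bilinear (hT : 0 < T) (L : Y →L[ℝ] Z →L[ℝ] W) {w : ℝ → Z} {γ B : ℝ}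
    (hv : DerivBound T k β v A) (hw : DerivBound T k γ w B) :
    DerivBound T k (β + γ) (fun t => L (v t) (w t)) (‖L‖ * 2 ^ k * A * B) := by
  have key : ∀ (b c : ℝ) (f : ℝ → Y) (g : ℝ → Z), (∀ t ∈ Ioc 0 T, ‖f t‖ ≤ A * t ^ b) →
      (∀ t ∈ Ioc 0 T, ‖g t‖ ≤ B * t ^ c) →
      ∀ t ∈ Ioc 0 T, ‖L (f t) (g t)‖ ≤ ‖L‖ * A * B * t ^ (b + c) := by
    intro b c f g hf hg t ht
    calc ‖L (f t) (g t)‖ ≤ ‖L‖ * ‖f t‖ * ‖g t‖ := L.le_opNorm₂ _ _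
      _ ≤ ‖L‖ * (A * t ^ b) * (B * t ^ c) := by
          gcongr
          · exact mul_nonneg (norm_nonneg L) ((norm_nonneg (f t)).trans (hf t ht))
          · exact hf t ht
          · exact hg t ht
      _ = _ := by rw [Real.rpow_add ht.1]; ring
  have hA := hv.nonneg hT
  have hB := hw.nonneg hT
  induction k generalizing β γ v w with
  | zero =>
    refine ⟨(L.continuous.comp_continuousOn hv.1).clm_apply hw.1, ?_⟩
    simpa using key _ _ v w hv.2 hw.2
  | succ k ih =>
    obtain ⟨h0, v', h1, h2⟩ := hv
    obtain ⟨h0', w', h1', h2'⟩ := hw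
    have hvk : DerivBound T k β v A := of_succ ⟨h0, v', h1, h2⟩
    have hwk : DerivBound T k γ w B := of_succ ⟨h0', w', h1', h2'⟩
    refine ⟨fun t ht => (key _ _ v w h0 h0' t ht).trans ?_, fun t => L (v t) (w' t) + L (v' t) (w t),
      fun t ht => ContinuousLinearMap.hasDerivWithinAt_of_bilinear (h1 t ht) (h1' t ht), ?_⟩
    · have h3 : (1 : ℝ) ≤ 2 ^ (k + 1) := one_le_pow₀ (by norm_num)
      have h4 := Real.rpow_nonneg ht.1.le (β + γ)
      have h5 : ‖L‖ ≤ ‖L‖ * 2 ^ (k + 1) := le_mul_of_one_le_right (norm_nonneg L) h3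
      gcongr
    · have e1 := ih hvk h2'
      have e2 := ih h2 hwk
      rw [← add_sub_assoc] at e1
      rw [sub_add_eq_add_sub] at e2
      convert e1.add e2 using 1
      ring

lemma clm_apply (hT : 0 < T) {L : ℝ → Y →L[ℝ] Z} {γ B : ℝ} (hL : DerivBound T k γ L B)
    (hv : DerivBound T k β v A) :
    DerivBound T k (γ + β) (fun t => L t (v t)) (2 ^ k * B * A) := by
  refine (hL.bilinear hT (ContinuousLinearMap.id ℝ (Y →L[ℝ] Z)) hv).mono ?_
  have := hL.nonneg hT
  have := hv.nonneg hT
  calc _ = ‖ContinuousLinearMap.id ℝ (Y →L[ℝ] Z)‖ * (2 ^ k * B * A) := by ring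
    _ ≤ 1 * (2 ^ k * B * A) := by gcongr; exact ContinuousLinearMap.norm_id_le
    _ = _ := one_mul _

lemma rpow (k : ℕ) (γ : ℝ) : ∃ C, 0 ≤ C ∧ DerivBound T k γ (fun t : ℝ => t ^ γ) C := by
  induction k generalizing γ with
  | zero =>
    refine ⟨1, zero_le_one, fun t ht => ?_, fun t ht => ?_⟩
    · exact (Real.continuousAt_rpow_const _ _ (Or.inl ht.1.ne')).continuousWithinAt
    · rw [Real.norm_of_nonneg (Real.rpow_nonneg ht.1.le _), one_mul]
  | succ k ih =>
    obtain ⟨C, hC, h⟩ := ih (γ - 1)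
    refine ⟨max 1 (|γ| * C), by positivity, fun t ht => ?_, fun t => γ • t ^ (γ - 1), fun t ht => ?_,
      (h.const_smul γ).mono (le_max_right _ _)⟩
    · have := Real.rpow_nonneg ht.1.le γ
      rw [Real.norm_of_nonneg this]
      exact le_mul_of_one_le_left this (le_max_left _ _)
    · exact (Real.hasDerivAt_rpow_const (Or.inl ht.1.ne')).hasDerivWithinAt

/-- Multiplication by a power of `t`. -/
lemma rpow_smul (hT : 0 < T) (k : ℕ) (γ : ℝ) : ∃ C, 0 ≤ C ∧ ∀ (v : ℝ → Y) (β A : ℝ),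
    DerivBound T k β v A → DerivBound T k (γ + β) (fun t => t ^ γ • v t) (C * A) := by
  obtain ⟨C, hC, h⟩ := rpow (T := T) k γ
  refine ⟨2 ^ k * C, by positivity, fun v β A hv => ?_⟩
  refine (h.bilinear hT (ContinuousLinearMap.lsmul ℝ ℝ) hv).mono ?_
  have := hv.nonneg hT
  calc _ = ‖(ContinuousLinearMap.lsmul ℝ ℝ : ℝ →L[ℝ] Y →L[ℝ] Y)‖ * (2 ^ k * C * A) := by ring
    _ ≤ 1 * (2 ^ k * C * A) := by
        gcongr; exact ContinuousLinearMap.opNorm_lsmul_le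
    _ = _ := one_mul _

lemma smul_id (hT : 0 < T) (k : ℕ) : ∃ C, 0 ≤ C ∧ ∀ (v : ℝ → Y) (β A : ℝ),
    DerivBound T k (β - 1) v A → DerivBound T k β (fun t => t • v t) (C * A) := by
  obtain ⟨C, hC, h⟩ := rpow_smul (Y := Y) hT k 1
  refine ⟨C, hC, fun v β A hv => ?_⟩
  have := h v _ A hv
  simpa using this

lemma inv_smul (hT : 0 < T) (k : ℕ) : ∃ C, 0 ≤ C ∧ ∀ (v : ℝ → Y) (β A : ℝ),
    DerivBound T k β v A → DerivBound T k (β - 1) (fun t => t⁻¹ • v t) (C * A) := by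
  obtain ⟨C, hC, h⟩ := rpow_smul (Y := Y) hT k (-1)
  refine ⟨C, hC, fun v β A hv => ?_⟩
  have := h v _ A hv
  rw [neg_add_eq_sub] at this
  exact this.congr fun t ht => by simp only [Real.rpow_neg_one]

/-- Derivatives of a function smooth up to the origin are bounded, which is stronger than `t^(-j)`;
each lowering of the exponent costs a factor T. In this form the coefficients enter the Leibniz
rule. -/
lemma of_contDiffOn (hT : 0 < T) (hv : ContDiffOn ℝ k v (Icc 0 T)) :
    ∃ A, 0 ≤ A ∧ DerivBound T k 0 v A := by
  induction k generalizing v with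
  | zero =>
    obtain ⟨A, hA, h⟩ := exists_norm_le_of_continuousOn hv.continuousOn
    exact ⟨A, hA, hv.continuousOn.mono Ioc_subset_Icc_self, fun t ht => by
      simpa using h t ⟨ht.1.le, ht.2⟩⟩
  | succ k ih =>
    obtain ⟨A, hA, h⟩ := exists_norm_le_of_continuousOn hv.continuousOn
    push_cast at hv
    obtain ⟨hd, -, hc⟩ := (contDiffOn_succ_iff_derivWithin (uniqueDiffOn_Icc hT)).1 hv
    obtain ⟨B, hB, h'⟩ := ih hc
    have h2 := h'.weaken (β' := 0 - 1) hB (by norm_num)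
    refine ⟨max A (B * T ^ (0 - (0 - 1) : ℝ)), by positivity, fun t ht => ?_, _, fun t ht => ?_,
      h2.mono (le_max_right _ _)⟩
    · rw [Real.rpow_zero, mul_one]
      exact (h t ⟨ht.1.le, ht.2⟩).trans (le_max_left _ _)
    · exact (hd t ⟨ht.1.le, ht.2⟩).hasDerivWithinAt.mono Ioc_subset_Icc_self

/-- Unique differentiability of (0,T] forces each derivative in the recursion to be `derivWithin`,
so the recursive notion matches the one in the theorem. -/
lemma iff_iteratedDerivWithin (k : ℕ) (β : ℝ) (v : ℝ → Y) (A : ℝ) :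
    DerivBound T k β v A ↔ ContDiffOn ℝ k v (Ioc 0 T) ∧
      ∀ j ≤ k, ∀ t ∈ Ioc 0 T, ‖iteratedDerivWithin j v (Ioc 0 T) t‖ ≤ A * t ^ (β - j) := by
  induction k generalizing β v with
  | zero =>
    simp only [DerivBound, Nat.cast_zero, contDiffOn_zero]
    refine and_congr_right fun _ => ⟨fun h j hj t ht => ?_, fun h t ht => ?_⟩
    · obtain rfl : j = 0 := by omega
      simpa using h t ht
    · simpa using h 0 le_rfl t ht
  | succ k ih =>
    have hu := uniqueDiffOn_Ioc (0 : ℝ) T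
    constructor
    · rintro ⟨h0, v', h1, h2⟩
      have hd : EqOn (derivWithin v (Ioc 0 T)) v' (Ioc 0 T) := fun t ht =>
        (h1 t ht).derivWithin (hu t ht)
      obtain ⟨h3, h4⟩ := (ih _ _).1 (h2.congr hd)
      refine ⟨?_, fun j hj t ht => ?_⟩
      · push_cast
        exact (contDiffOn_succ_iff_derivWithin hu).2
          ⟨fun t ht => (h1 t ht).differentiableWithinAt, by simp, h3⟩
      · cases j with
        | zero => simpa using h0 t ht
        | succ j =>
          rw [iteratedDerivWithin_succ']
          have := h4 j (by omega) t ht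
          push_cast
          rwa [sub_sub, add_comm] at this
    · rintro ⟨h, h'⟩
      push_cast at h
      obtain ⟨hd, -, hc⟩ := (contDiffOn_succ_iff_derivWithin hu).1 h
      refine ⟨fun t ht => by simpa using h' 0 (by omega) t ht, derivWithin v (Ioc 0 T),
        fun t ht => (hd t ht).hasDerivWithinAt, (ih _ _).2 ⟨hc, fun j hj t ht => ?_⟩⟩
      have := h' (j + 1) (by omega) t ht
      rw [iteratedDerivWithin_succ'] at this
      push_cast at this
      rwa [sub_sub, add_comm (1 : ℝ)]

end DerivBound

/-- `v` is continuous and bounded by `A` on `[0,T]`, it is `C^k` on `(0,T]`, and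
`‖v^{(j)}(t)‖ ≤ A t^(α-j)` for `1 ≤ j ≤ k`. -/
structure WeightedBound (T α : ℝ) (k : ℕ) (v : ℝ → Y) (A : ℝ) : Prop where
  continuousOn : ContinuousOn v (Icc 0 T)
  bound : ∀ t ∈ Icc 0 T, ‖v t‖ ≤ A
  deriv : ∀ j, k = j + 1 → ∃ v' : ℝ → Y,
    (∀ t ∈ Ioc 0 T, HasDerivWithinAt v (v' t) (Ioc 0 T) t) ∧ DerivBound T j (α - 1) v' A

namespace WeightedBound

variable {T α : ℝ} {k : ℕ} {v : ℝ → Y} {A : ℝ}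

lemma nonneg (hT : 0 ≤ T) (h : WeightedBound T α k v A) : 0 ≤ A :=
  (norm_nonneg _).trans (h.bound 0 ⟨le_rfl, hT⟩)

lemma zero (hc : ContinuousOn v (Icc 0 T)) (hb : ∀ t ∈ Icc 0 T, ‖v t‖ ≤ A) :
    WeightedBound T α 0 v A := ⟨hc, hb, fun j hj => by omega⟩

lemma mono {A' : ℝ} (h : WeightedBound T α k v A) (hA : A ≤ A') : WeightedBound T α k v A' :=
  ⟨h.continuousOn, fun t ht => (h.bound t ht).trans hA, fun j hj => by
    obtain ⟨v', h1, h2⟩ := h.deriv j hj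
    exact ⟨v', h1, h2.mono hA⟩⟩

lemma of_le {i : ℕ} (hi : i ≤ k) (h : WeightedBound T α k v A) : WeightedBound T α i v A :=
  ⟨h.continuousOn, h.bound, fun j hj => by
    obtain ⟨v', h1, h2⟩ := h.deriv (k - 1) (by omega)
    exact ⟨v', h1, h2.of_le (by omega)⟩⟩

/-- Forgets the gain `t^α` in the derivatives, since `t^(α-j) ≤ T^α t^(-j)`. The function itself
need not vanish at 0, so exponent 0 is the best available. -/
lemma derivBound (hT : 0 < T) (hα : 0 ≤ α) (h : WeightedBound T α k v A) :
    DerivBound T k 0 v ((1 + T ^ α) * A) := by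
  have hA := h.nonneg hT.le
  have hTα := Real.rpow_nonneg hT.le α
  have h1 : A ≤ (1 + T ^ α) * A := by nlinarith
  cases k with
  | zero =>
    exact ⟨h.continuousOn.mono Ioc_subset_Icc_self, fun t ht => by
      rw [Real.rpow_zero, mul_one]; exact (h.bound t ⟨ht.1.le, ht.2⟩).trans h1⟩
  | succ k =>
    obtain ⟨v', h2, h3⟩ := h.deriv k rfl
    refine ⟨fun t ht => ?_, v', h2, (h3.weaken (β' := 0 - 1) hA (by linarith)).mono ?_⟩
    · rw [Real.rpow_zero, mul_one]; exact (h.bound t ⟨ht.1.le, ht.2⟩).trans h1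
    · rw [sub_sub_sub_cancel_right, sub_zero]; nlinarith

/-- The bound `A t^α` with α > 0 squeezes v to `v 0 = 0`, which supplies the continuity at the
origin that estimates on (0,T] cannot see. -/
lemma of_derivBound (hT : 0 < T) (hα : 0 < α) (h : DerivBound T k α v A) (h0 : v 0 = 0) :
    WeightedBound T α k v ((1 + T ^ α) * A) := by
  have hA := h.nonneg hT
  have hTα := Real.rpow_nonneg hT.le α
  have hb : ∀ t ∈ Icc 0 T, ‖v t‖ ≤ A * t ^ α := fun t ht => by
    rcases ht.1.eq_or_lt with rfl | h1
    · simp [h0, Real.zero_rpow hα.ne']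
    · exact h.bound t ⟨h1, ht.2⟩
  refine ⟨fun t ht => ?_, fun t ht => (hb t ht).trans ?_, fun j hj => ?_⟩
  · rcases ht.1.eq_or_lt with rfl | h1
    · have : Tendsto (fun s : ℝ => A * s ^ α) (𝓝[Icc 0 T] 0) (𝓝 (A * 0 ^ α)) :=
        ((Real.continuous_rpow_const hα.le).continuousWithinAt).const_mul A
      rw [Real.zero_rpow hα.ne', mul_zero] at this
      rw [ContinuousWithinAt, h0]
      refine squeeze_zero_norm' ?_ this
      filter_upwards [self_mem_nhdsWithin] with s hs using hb s hs
    · have hmem : Ioi (0 : ℝ) ∈ 𝓝 t := Ioi_mem_nhds h1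
      refine ((h.continuousOn t ⟨h1, ht.2⟩).mono_of_mem_nhdsWithin ?_)
      filter_upwards [self_mem_nhdsWithin, mem_nhdsWithin_of_mem_nhds hmem] with s hs hs'
        using ⟨hs', hs.2⟩
  · have : t ^ α ≤ T ^ α := Real.rpow_le_rpow ht.1 ht.2 hα.le
    nlinarith
  · subst hj
    obtain ⟨-, v', h1, h2⟩ := h
    exact ⟨v', h1, h2.mono (by nlinarith)⟩

/-- Fractional integration in the weighted spaces. -/
lemma exists_frac (hT : 0 < T) (hα : 0 < α) (k : ℕ) : ∃ C, 0 ≤ C ∧ ∀ (u : ℝ → Y) A,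
    WeightedBound T α k u A → DerivBound T k α (frac α u) (C * A) := by
  have hI := integral_omega_one_sub_nonneg hα
  set I := ∫ σ in (0 : ℝ)..1, omega α (1 - σ)
  have hbd : ∀ k (u : ℝ → Y) A, WeightedBound T α k u A →
      ∀ t ∈ Ioc 0 T, ‖frac α u t‖ ≤ I * A * t ^ α := fun k u A hu t ht =>
    norm_frac_le hα ⟨ht.1.le, ht.2⟩ hu.bound
  induction k with
  | zero =>
    exact ⟨I, hI, fun u A hu => ⟨(continuousOn_frac hα hu.continuousOn).mono Ioc_subset_Icc_self,
      hbd 0 u A hu⟩⟩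
  | succ k ih =>
    obtain ⟨C, hC, h⟩ := ih
    obtain ⟨D, hD, hid⟩ := DerivBound.smul_id (Y := Y) hT k
    obtain ⟨D', hD', hinv⟩ := DerivBound.inv_smul (Y := Y) hT k
    have hTα := Real.rpow_nonneg hT.le α
    refine ⟨max I (D' * (|α| * C + C * ((1 + T ^ α) * D))), by positivity, fun u A hu => ?_⟩
    have hA := hu.nonneg hT.le
    obtain ⟨u', h1, h2⟩ := hu.deriv k rfl
    -- `w = t u'` has order k, so both terms of `t (I^α u)' = α I^α u + I^α w` fall under the
    -- induction hypothesis; dividing by t then gives the derivative.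
    have hw := of_derivBound hT hα (hid u' α A h2) (by simp)
    have h3 : ∀ t ∈ Ioc 0 T, HasDerivWithinAt u (t⁻¹ • (t • u' t)) (Ioc 0 T) t := fun t ht => by
      rw [inv_smul_smul₀ ht.1.ne']; exact h1 t ht
    refine ⟨fun t ht => (hbd _ u A hu t ht).trans ?_, _, fun t ht =>
      hasDerivWithinAt_frac hα hu.continuousOn hw.continuousOn h3 ht, ?_⟩
    · have := Real.rpow_nonneg ht.1.le α
      gcongr
      exact le_max_left _ _
    · refine (hinv _ α _ (((h u A (hu.of_le k.le_succ)).const_smul α).add (h _ _ hw))).mono ?_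
      calc _ = D' * (|α| * C + C * ((1 + T ^ α) * D)) * A := by ring
        _ ≤ _ := by gcongr; exact le_max_right _ _

end WeightedBound

end derivBound

/-! ### Regularity of solutions of weakly singular Volterra equations -/

section regularity

variable {Y : Type*} [NormedAddCommGroup Y] [NormedSpace ℝ Y] {T α : ℝ}

lemma frac_zero {γ : ℝ} (hγ : 0 < γ) (u : ℝ → Y) : frac γ u 0 = 0 := by
  rw [frac, Real.zero_rpow hγ.ne', zero_smul]

/-- Half of the order α is spent on the decay in `μ`, the other half on the factor `t^(α/2)`. -/
lemma isVolterra_clm_frac (hα : 0 < α) (hα1 : α ≤ 1) {B : ℝ → Y →L[ℝ] Y}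
    (hB : ContinuousOn B (Icc 0 T)) : IsVolterra T (α / 2) fun u t => B t (frac α u t) :=
  (isVolterra_frac (half_pos hα) (by linarith) (by linarith)).clm_apply hB

/-- The solution of `u + B I^α u = h` is differentiable on `(0,T]`, and `t u'(t)` solves an
equation of the same form. -/
lemma exists_hasDerivWithinAt_of_frac_eq [CompleteSpace Y] (hT : 0 < T) (hα : 0 < α) (hα1 : α ≤ 1)
    {B B' : ℝ → Y →L[ℝ] Y} (hB : ContinuousOn B (Icc 0 T)) (hB' : ContinuousOn B' (Icc 0 T))
    (hBd : ∀ t ∈ Ioc 0 T, HasDerivWithinAt B (B' t) (Ioc 0 T) t)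
    {u h h' : ℝ → Y} {A : ℝ} (hu : ContinuousOn u (Icc 0 T)) (hh : ContinuousOn h (Icc 0 T))
    (hhd : ∀ t ∈ Ioc 0 T, HasDerivWithinAt h (h' t) (Ioc 0 T) t)
    (hh' : DerivBound T 0 (α - 1) h' A)
    (heq : ∀ t ∈ Icc 0 T, u t + B t (frac α u t) = h t) :
    ∃ w : ℝ → Y, ContinuousOn w (Icc 0 T) ∧
      (∀ t ∈ Ioc 0 T, HasDerivWithinAt u (t⁻¹ • w t) (Ioc 0 T) t) ∧
      ∀ t ∈ Icc 0 T,
        w t + B t (frac α w t) = t • h' t - (t • B' t + α • B t) (frac α u t) := by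
  -- The commutator of `t d/dt` with `B I^α`.
  set E : ℝ → Y →L[ℝ] Y := fun t => t • B' t + α • B t with hE
  have hEc : ContinuousOn E (Icc 0 T) := (continuousOn_id.smul hB').add (hB.const_smul α)
  have hV := isVolterra_clm_frac hα hα1 hB
  have hVE := isVolterra_clm_frac hα hα1 hEc
  obtain ⟨D, hD, hid⟩ := DerivBound.smul_id (Y := Y) hT 0
  have hth := hid h' α A hh'
  have hthc := (WeightedBound.of_derivBound hT hα hth (by simp)).continuousOn
  -- u is not yet known to be differentiable. The candidate w for `t u'` is defined as the solution
  -- of the formally differentiated equation; the rest of the proof shows that integrating `s⁻¹ w`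
  -- recovers u.
  obtain ⟨w, hw, hweq⟩ := hV.exists_solution (half_pos hα) hT.le
    (hthc.sub (hVE.continuousOn u hu))
  have hfracb : ∀ (G : ℝ → Y →L[ℝ] Y) (z : ℝ → Y), ContinuousOn G (Icc 0 T) →
      ContinuousOn z (Icc 0 T) → ∃ C, ∀ t ∈ Ioc 0 T, ‖G t (frac α z t)‖ ≤ C * t ^ α := by
    intro G z hG hz
    obtain ⟨b, hb0, hb⟩ := exists_norm_le_of_continuousOn hG
    obtain ⟨c, hc0, hc⟩ := exists_norm_le_of_continuousOn hz
    refine ⟨b * ((∫ σ in (0 : ℝ)..1, omega α (1 - σ)) * c), fun t ht => ?_⟩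
    have ht' : t ∈ Icc 0 T := ⟨ht.1.le, ht.2⟩
    rw [mul_assoc]
    exact (G t).le_of_opNorm_le_of_le (hb t ht') (norm_frac_le hα ht' hc)
  have hinvb : ∀ (z : ℝ → Y) C, (∀ t ∈ Ioc 0 T, ‖z t‖ ≤ C * t ^ α) →
      ∀ t ∈ Ioc 0 T, ‖t⁻¹ • z t‖ ≤ C * t ^ (α - 1) := by
    intro z C hz t ht
    rw [norm_smul, norm_inv, Real.norm_of_nonneg ht.1.le, Real.rpow_sub_one ht.1.ne', inv_mul_eq_div,
      ← mul_div_assoc]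
    have := ht.1
    gcongr
    exact hz t ht
  have hinvc : ∀ z : ℝ → Y, ContinuousOn z (Icc 0 T) →
      ContinuousOn (fun t => t⁻¹ • z t) (Ioc 0 T) := fun z hz =>
    (continuousOn_id.inv₀ fun s hs => hs.1.ne').smul (hz.mono Ioc_subset_Icc_self)
  -- Every term of the equation for w is `O(t^α)`, hence so is w, and `s⁻¹ w` is integrable at 0.
  obtain ⟨A', hA'⟩ : ∃ A', ∀ t ∈ Ioc 0 T, ‖w t‖ ≤ A' * t ^ α := by
    obtain ⟨C₁, h1⟩ := hfracb E u hEc hu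
    obtain ⟨C₂, h2⟩ := hfracb B w hB hw
    refine ⟨D * A + C₁ + C₂, fun t ht => ?_⟩
    have : w t = t • h' t - E t (frac α u t) - B t (frac α w t) :=
      eq_sub_of_add_eq (hweq t ⟨ht.1.le, ht.2⟩)
    rw [this, add_mul, add_mul]
    exact norm_sub_le_of_le (norm_sub_le_of_le (hth.bound t ht) (h1 t ht)) (h2 t ht)
  have hgc := hinvc w hw
  have hgb := hinvb w A' hA'
  have hα' : -1 < α - 1 := by linarith
  set v : ℝ → Y := fun t => u 0 + ∫ s in (0 : ℝ)..t, s⁻¹ • w s with hv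
  have hvc : ContinuousOn v (Icc 0 T) :=
    continuousOn_const.add (continuousOn_primitive_of_norm_le_rpow hT.le hα' hgc hgb)
  have hvd : ∀ t ∈ Ioc 0 T, HasDerivWithinAt v (t⁻¹ • w t) (Ioc 0 T) t := fun t ht =>
    (hasDerivWithinAt_primitive hα' hgc hgb ht).const_add _
  have hr : ContinuousOn (v - u) (Icc 0 T) := hvc.sub hu
  -- The equation for w cancels everything in the derivative of the residual of v except the
  -- commutator acting on v - u.
  have hed : ∀ t ∈ Ioc 0 T, HasDerivWithinAt (fun t => v t + B t (frac α v t) - h t)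
      (t⁻¹ • E t (frac α (v - u) t)) (Ioc 0 T) t := by
    intro t ht
    have ht' : t ∈ Icc 0 T := ⟨ht.1.le, ht.2⟩
    have h1 := ((hvd t ht).add ((hBd t ht).clm_apply
      (hasDerivWithinAt_frac hα hvc hw hvd ht))).sub (hhd t ht)
    refine h1.congr_deriv ?_
    rw [hVE.map_sub v u hvc hu t ht']
    have h2 : h' t = t⁻¹ • (w t + B t (frac α w t) + E t (frac α u t)) := by
      rw [hweq t ht', Pi.sub_apply, sub_add_cancel, inv_smul_smul₀ ht.1.ne']
    have h3 : E t (frac α v t) = t • B' t (frac α v t) + α • B t (frac α v t) := rfl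
    have h4 : B' t (frac α v t) = t⁻¹ • t • B' t (frac α v t) := by
      rw [inv_smul_smul₀ ht.1.ne']
    rw [h2, h4, h3]
    simp only [map_add, map_smul, smul_add, smul_sub]
    abel
  have he : ∀ t ∈ Icc 0 T, ∫ s in (0 : ℝ)..t, s⁻¹ • E s (frac α (v - u) s)
      = v t + B t (frac α v t) - h t := by
    intro t ht
    obtain ⟨C, hC⟩ := hfracb E (v - u) hEc hr
    rw [primitive_of_hasDerivWithinAt hα' ((hvc.add (hV.continuousOn v hvc)).sub hh)
      (hinvc _ (hVE.continuousOn _ hr)) (hinvb _ C hC) hed ht]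
    have h0 := heq 0 ⟨le_rfl, hT.le⟩
    rw [frac_zero hα, map_zero, add_zero] at h0
    have h1 : v 0 = u 0 := by simp [hv]
    simp only [Pi.sub_apply, Pi.add_apply]
    rw [frac_zero hα, map_zero, h1, h0]
    simp
  -- The residual vanishes at 0, so r = v - u satisfies `r + B I^α r - ∫ s⁻¹ E I^α r = 0`. This is
  -- again of Volterra type, so r = 0.
  have hW := hV.sub (hVE.integral_inv_smul hT.le (half_pos hα))
  have huv : EqOn u v (Icc 0 T) := by
    obtain ⟨C, -, hC⟩ := hW.exists_apriori (half_pos hα)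
    intro t ht
    have := hC (v - u) 0 hr (fun s hs => by
      rw [he s hs, hV.map_sub v u hvc hu s hs, ← heq s hs, Pi.sub_apply]
      refine le_of_eq (norm_eq_zero.2 ?_)
      abel) t ht
    rw [mul_zero] at this
    exact (sub_eq_zero.1 (norm_le_zero_iff.1 this)).symm
  exact ⟨w, hw, fun t ht => (hvd t ht).congr (fun s hs => huv ⟨hs.1.le, hs.2⟩)
    (huv ⟨ht.1.le, ht.2⟩), hweq⟩

/-- Regularity for `u + B I^α u = h`. -/
lemma exists_weightedBound_of_frac_eq [CompleteSpace Y] (hT : 0 < T) (hα : 0 < α) (hα1 : α ≤ 1) (k : ℕ)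
    {B : ℝ → Y →L[ℝ] Y} (hB : ContDiffOn ℝ k B (Icc 0 T)) :
    ∃ C, 0 ≤ C ∧ ∀ (u h : ℝ → Y) A, ContinuousOn u (Icc 0 T) → WeightedBound T α k h A →
      (∀ t ∈ Icc 0 T, u t + B t (frac α u t) = h t) → WeightedBound T α k u (C * A) := by
  have hV := isVolterra_clm_frac hα hα1 hB.continuousOn
  obtain ⟨C₀, hC₀, hap⟩ := hV.exists_apriori (half_pos hα)
  have hb : ∀ k (u h : ℝ → Y) A, ContinuousOn u (Icc 0 T) → WeightedBound T α k h A →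
      (∀ t ∈ Icc 0 T, u t + B t (frac α u t) = h t) → ∀ t ∈ Icc 0 T, ‖u t‖ ≤ C₀ * A :=
    fun k u h A hu hh heq => hap u A hu fun t ht => by rw [heq t ht]; exact hh.bound t ht
  induction k with
  | zero =>
    exact ⟨C₀, by linarith, fun u h A hu hh heq => WeightedBound.zero hu (hb 0 u h A hu hh heq)⟩
  | succ k ih =>
    have hBk : ContDiffOn ℝ k B (Icc 0 T) := hB.of_le (by exact_mod_cast k.le_succ)
    obtain ⟨C, hC, hP⟩ := ih hBk
    have hB1 := hB
    push_cast at hB1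
    obtain ⟨hd, -, hB'⟩ := (contDiffOn_succ_iff_derivWithin (uniqueDiffOn_Icc hT)).1 hB1
    set B' := derivWithin B (Icc 0 T)
    have hE : ContDiffOn ℝ k (fun t => t • B' t + α • B t) (Icc 0 T) :=
      (contDiffOn_id.smul hB').add (hBk.const_smul α)
    obtain ⟨e, he, hEb⟩ := DerivBound.of_contDiffOn hT hE
    obtain ⟨b, hb0, hBb⟩ := DerivBound.of_contDiffOn hT hBk
    obtain ⟨F, hF, hfrac⟩ := WeightedBound.exists_frac (Y := Y) hT hα k
    obtain ⟨D, hD, hid⟩ := DerivBound.smul_id (Y := Y) hT k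
    obtain ⟨D', hD', hinv⟩ := DerivBound.inv_smul (Y := Y) hT k
    have hTα := Real.rpow_nonneg hT.le α
    -- `C₁` bounds the right-hand side of the equation for w, `C₂` bounds w in the weighted space,
    -- and `C₃` bounds w with the decay `t^α`.
    set C₁ := D + 2 ^ k * e * (F * C) with hC₁
    set C₂ := C * ((1 + T ^ α) * C₁) with hC₂
    have hC₁0 : 0 ≤ C₁ := by positivity
    have hC₂0 : 0 ≤ C₂ := by positivity
    set C₃ := C₁ + 2 ^ k * b * (F * C₂) with hC₃
    refine ⟨max C₀ (D' * C₃), by positivity, fun u h A hu hh heq => ?_⟩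
    have hA := hh.nonneg hT.le
    obtain ⟨h', h1, h2⟩ := hh.deriv k rfl
    obtain ⟨w, hw, hud, hweq⟩ := exists_hasDerivWithinAt_of_frac_eq hT hα hα1 hB.continuousOn
      hB'.continuousOn (fun t ht => (hd t ⟨ht.1.le, ht.2⟩).hasDerivWithinAt.mono
        Ioc_subset_Icc_self) hu hh.continuousOn h1 (h2.of_le k.zero_le) heq
    have huk := hP u h A hu (hh.of_le k.le_succ) heq
    have h3 : DerivBound T k α (fun t => t • h' t - (t • B' t + α • B t) (frac α u t))
        (C₁ * A) := by
      have := hEb.clm_apply hT (hfrac u _ huk)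
      rw [zero_add] at this
      refine ((hid h' α A h2).sub this).mono (le_of_eq ?_)
      ring
    have h4 := WeightedBound.of_derivBound hT hα h3 (by simp [frac_zero hα])
    -- Second use of the induction hypothesis: w solves the same equation as u, with a right-hand
    -- side of order k because u already has order k.
    have hwk := (hP w _ _ hw h4 hweq).mono (A' := C₂ * A) (le_of_eq (by rw [hC₂]; ring))
    -- The weighted bound only says that w itself is bounded. Reading w off its equation restores
    -- the decay `t^α`, which `t⁻¹ w` needs.
    have h5 : DerivBound T k α w (C₃ * A) := by
      have := hBb.clm_apply hT (hfrac w _ hwk)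
      rw [zero_add] at this
      refine ((h3.sub this).mono (le_of_eq ?_)).congr fun t ht =>
        eq_sub_of_add_eq (hweq t ⟨ht.1.le, ht.2⟩)
      rw [hC₃]; ring
    refine ⟨hu, fun t ht => (hb _ u h A hu hh heq t ht).trans ?_, fun j hj => ?_⟩
    · gcongr; exact le_max_left _ _
    · obtain rfl : k = j := by omega
      refine ⟨_, hud, (hinv w α _ h5).mono ?_⟩
      rw [← mul_assoc]
      gcongr; exact le_max_right _ _

/-- The operator `B I^α u + ∫ D u - ∫ B' I^α u`. -/
def volterraOp (α : ℝ) (B B' D : ℝ → Y →L[ℝ] Y) (u : ℝ → Y) (t : ℝ) : Y :=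
  B t (frac α u t) + ∫ s in (0 : ℝ)..t, (D s (u s) - B' s (frac α u s))

/-- The outer integral is `I^1`, so for continuous u the operator is built from `I^α`, `I^1` and
continuous multipliers by sums and compositions. -/
lemma isVolterra_volterraOp (hα : 0 < α) (hα1 : α ≤ 1) {B B' D : ℝ → Y →L[ℝ] Y}
    (hB : ContinuousOn B (Icc 0 T)) (hB' : ContinuousOn B' (Icc 0 T))
    (hD : ContinuousOn D (Icc 0 T)) : IsVolterra T (α / 2) (volterraOp α B B' D) := by
  have h1 : IsVolterra T (α / 2) (frac 1 : (ℝ → Y) → ℝ → Y) :=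
    isVolterra_frac (half_pos hα) (by linarith) (by linarith)
  have h2 := (isVolterra_clm_frac hα hα1 hB).add
    ((h1.comp_clm_apply hD).sub (h1.comp (half_pos hα).le (isVolterra_clm_frac hα hα1 hB')))
  have hcont : ∀ u : ℝ → Y, ContinuousOn u (Icc 0 T) → ∀ t ∈ Icc 0 T,
      volterraOp α B B' D u t = B t (frac α u t) +
        (frac 1 (fun s => D s (u s)) t - frac 1 (fun s => B' s (frac α u s)) t) := by
    intro u hu t ht
    rw [frac_one ht.1, frac_one ht.1, volterraOp, intervalIntegral.integral_sub]
    · refine ContinuousOn.intervalIntegrable ?_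
      rw [uIcc_of_le ht.1]
      exact (hD.clm_apply hu).mono (Icc_subset_Icc_right ht.2)
    · refine ContinuousOn.intervalIntegrable ?_
      rw [uIcc_of_le ht.1]
      exact (hB'.clm_apply (continuousOn_frac hα hu)).mono (Icc_subset_Icc_right ht.2)
  refine ⟨fun u hu => (h2.continuousOn u hu).congr (hcont u hu), fun u v hu hv t ht => ?_, ?_⟩
  · rw [hcont _ (hu.sub hv) t ht, hcont u hu t ht, hcont v hv t ht]
    exact h2.map_sub u v hu hv t ht
  · obtain ⟨C, hC, hb⟩ := h2.bound
    refine ⟨C, hC, fun μ hμ u N hu hN hu' t ht => ?_⟩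
    rw [hcont u hu t ht]
    exact hb μ hμ u N hu hN hu' t ht

/-- Regularity for the equation `u + B I^α u + ∫ D u - ∫ B' I^α u = f`. -/
lemma exists_weightedBound_of_volterraOp_eq [CompleteSpace Y] (hT : 0 < T) (hα : 0 < α) (hα1 : α ≤ 1) (k : ℕ)
    {B B' D : ℝ → Y →L[ℝ] Y} (hB : ContDiffOn ℝ k B (Icc 0 T))
    (hB' : ContDiffOn ℝ (k - 1 : ℕ) B' (Icc 0 T)) (hD : ContDiffOn ℝ k D (Icc 0 T)) :
    ∃ C, 0 ≤ C ∧ ∀ (u f : ℝ → Y) A, ContinuousOn u (Icc 0 T) → WeightedBound T α k f A →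
      (∀ t ∈ Icc 0 T, u t + volterraOp α B B' D u t = f t) → WeightedBound T α k u (C * A) := by
  induction k with
  | zero =>
    obtain ⟨C, hC, h⟩ := (isVolterra_volterraOp hα hα1 hB.continuousOn hB'.continuousOn
      hD.continuousOn).exists_apriori (half_pos hα)
    exact ⟨C, by linarith, fun u f A hu hf heq => WeightedBound.zero hu
      (h u A hu fun t ht => by rw [heq t ht]; exact hf.bound t ht)⟩
  | succ k ih =>
    rw [Nat.add_sub_cancel] at hB'
    have hDk : ContDiffOn ℝ k D (Icc 0 T) := hD.of_le (by exact_mod_cast k.le_succ)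
    obtain ⟨C, hC, hP⟩ := ih (hB.of_le (by exact_mod_cast k.le_succ))
      (hB'.of_le (by exact_mod_cast k.sub_le 1)) hDk
    obtain ⟨K, hK, hreg⟩ := exists_weightedBound_of_frac_eq hT hα hα1 (k + 1) hB
    obtain ⟨δ, hδ, hDb⟩ := DerivBound.of_contDiffOn hT hDk
    obtain ⟨b, hb, hBb⟩ := DerivBound.of_contDiffOn hT hB'
    obtain ⟨F, hF, hfrac⟩ := WeightedBound.exists_frac (Y := Y) hT hα k
    have hTα := Real.rpow_nonneg hT.le α
    -- The powers of T arise from lowering the exponents 0 of `D u` and α of `B' I^α u` to the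
    -- common value α - 1.
    set G := 2 ^ k * δ * ((1 + T ^ α) * C) * T ^ (0 + 0 - (α - 1))
      + 2 ^ k * b * (F * C) * T ^ (0 + α - (α - 1)) with hG
    have hG0 : 0 ≤ G := by positivity
    refine ⟨K * (1 + G + G * (T ^ α / α)), by positivity, fun u f A hu hf heq => ?_⟩
    have hA := hf.nonneg hT.le
    have huk := hP u f A hu (hf.of_le k.le_succ) heq
    set g : ℝ → Y := fun s => D s (u s) - B' s (frac α u s) with hg
    have hgb : DerivBound T k (α - 1) g (G * A) := by
      have h1 := (hDb.clm_apply hT (huk.derivBound hT hα.le)).weaken (β' := α - 1) (by positivity)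
        (by linarith)
      have h2 := (hBb.clm_apply hT (hfrac u _ huk)).weaken (β' := α - 1) (by positivity)
        (by linarith)
      refine (h1.sub h2).mono (le_of_eq ?_)
      rw [hG]; ring
    have hα' : -1 < α - 1 := by linarith
    obtain ⟨f', h1, h2⟩ := hf.deriv k rfl
    -- g has order k and exponent α - 1, exactly what the derivative of a weighted function of order
    -- k + 1 may have. Moving its primitive to the right leaves `u + B I^α u = h` with h of order k
    -- + 1.
    have hh : WeightedBound T α (k + 1) (fun t => f t - ∫ s in (0 : ℝ)..t, g s)
        ((1 + G + G * (T ^ α / α)) * A) := by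
      refine ⟨hf.continuousOn.sub (continuousOn_primitive_of_norm_le_rpow hT.le hα'
        hgb.continuousOn hgb.bound), fun t ht => ?_, fun j hj => ?_⟩
      · have h3 := norm_primitive_le hα' hgb.bound ht
        rw [sub_add_cancel] at h3
        have h4 : t ^ α ≤ T ^ α := Real.rpow_le_rpow ht.1 ht.2 hα.le
        calc _ ≤ A + G * A * (t ^ α / α) := norm_sub_le_of_le (hf.bound t ht) h3
          _ ≤ A + G * A * (T ^ α / α) := by gcongr
          _ ≤ A + G * A * (T ^ α / α) + G * A := le_add_of_nonneg_right (by positivity)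
          _ = _ := by ring
      · obtain rfl : k = j := by omega
        refine ⟨fun t => f' t - g t, fun t ht => (h1 t ht).sub
          (hasDerivWithinAt_primitive hα' hgb.continuousOn hgb.bound ht), (h2.sub hgb).mono ?_⟩
        have : 0 ≤ G * (T ^ α / α) * A := by positivity
        linarith
    rw [mul_assoc]
    refine hreg u _ _ hu hh fun t ht => ?_
    rw [← heq t ht, volterraOp]
    abel

end regularity

/-! ### The iterated kernel -/

section kernel

variable {Y Z : Type*} [NormedAddCommGroup Y] [NormedSpace ℝ Y] [NormedAddCommGroup Z]
  [NormedSpace ℝ Z] {T α : ℝ}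

lemma intervalIntegrable_omega_smul (hα : 0 < α) {B : ℝ → Z} (hB : ContinuousOn B (Icc 0 T))
    {s t : ℝ} (hs : 0 ≤ s) (hst : s ≤ t) (ht : t ≤ T) :
    IntervalIntegrable (fun z => omega α (z - s) • B z) volume s t := by
  obtain ⟨b, hb0, hb⟩ := exists_norm_le_of_continuousOn hB
  have h0 : IntervalIntegrable (fun z : ℝ => omega α (z - s)) volume s t := by
    have := ((intervalIntegral.intervalIntegrable_rpow' (a := 0) (b := t - s)
      (by linarith : -1 < α - 1)).div_const (Real.Gamma α)).comp_sub_right s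
    simpa [omega] using this
  have hsub : Ioc s t ⊆ Icc 0 T := fun z hz => ⟨hs.trans hz.1.le, hz.2.trans ht⟩
  refine (h0.mul_const b).mono_fun' ?_ ?_
  · rw [uIoc_of_le hst]
    exact ((measurable_omega α).comp
      (measurable_id.sub measurable_const)).aestronglyMeasurable.smul
      ((hB.mono hsub).aestronglyMeasurable measurableSet_Ioc)
  · rw [uIoc_of_le hst]
    filter_upwards [ae_restrict_mem measurableSet_Ioc] with z hz
    have h1 := omega_nonneg hα (sub_nonneg.2 hz.1.le)
    rw [norm_smul, Real.norm_of_nonneg h1]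
    gcongr
    exact hb z (hsub hz)

lemma intervalIntegrable_omega_sub_smul (hα : 0 < α) {u : ℝ → Z} (hu : ContinuousOn u (Icc 0 T))
    {t : ℝ} (ht : t ∈ Icc 0 T) :
    IntervalIntegrable (fun s => omega α (t - s) • u s) volume 0 t := by
  obtain ⟨b, hb0, hb⟩ := exists_norm_le_of_continuousOn hu
  have hω : IntervalIntegrable (fun s => omega α (t - s)) volume 0 t := by
    have := ((intervalIntegral.intervalIntegrable_rpow' (a := 0) (b := t)
      (by linarith : -1 < α - 1)).div_const (Real.Gamma α)).comp_sub_left t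
    simpa [omega] using this.symm
  have hsub : Ioc 0 t ⊆ Icc 0 T := fun s hs => ⟨hs.1.le, hs.2.trans ht.2⟩
  refine (hω.mul_const b).mono_fun' ?_ ?_
  · rw [uIoc_of_le ht.1]
    exact ((measurable_omega α).comp
      (measurable_const.sub measurable_id)).aestronglyMeasurable.smul
      ((hu.mono hsub).aestronglyMeasurable measurableSet_Ioc)
  · rw [uIoc_of_le ht.1]
    filter_upwards [ae_restrict_mem measurableSet_Ioc] with s hs
    have h1 := omega_nonneg hα (sub_nonneg.2 hs.2)
    rw [norm_smul, Real.norm_of_nonneg h1]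
    gcongr
    exact hb s (hsub hs)

lemma map_weakly_singular_kernel [CompleteSpace Y] [CompleteSpace Z] (L : Z →L[ℝ] Y) (hα : 0 < α)
    (A D : Z) {B : ℝ → Z} (hB : ContinuousOn B (Icc 0 T)) {s t : ℝ} (hs : 0 ≤ s) (hst : s ≤ t)
    (ht : t ≤ T) (r : ℝ) : L (r • A + D - ∫ z in s..t, omega α (z - s) • B z)
      = r • L A + L D - ∫ z in s..t, omega α (z - s) • L (B z) := by
  rw [map_sub, map_add, map_smul,
    ← L.intervalIntegral_comp_comm (intervalIntegrable_omega_smul hα hB hs hst ht)]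
  simp only [map_smul]

/-- Fubini's theorem for `∫₀ᵗ (∫ₛᵗ ω_α(z-s) B(z) dz) u(s) ds = ∫₀ᵗ B(z) (I^α u)(z) dz`. -/
lemma integral_kernel_apply [CompleteSpace Y] (hα : 0 < α) {B : ℝ → Y →L[ℝ] Y}
    (hB : ContinuousOn B (Icc 0 T)) {u : ℝ → Y} (hu : ContinuousOn u (Icc 0 T)) {t : ℝ}
    (ht : t ∈ Icc 0 T) :
    IntervalIntegrable (fun s => (∫ z in s..t, omega α (z - s) • B z) (u s)) volume 0 t ∧
      ∫ s in (0 : ℝ)..t, (∫ z in s..t, omega α (z - s) • B z) (u s)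
        = ∫ z in (0 : ℝ)..t, B z (frac α u z) := by
  have hsub : Ioc 0 t ⊆ Icc 0 T := fun z hz => ⟨hz.1.le, hz.2.trans ht.2⟩
  obtain ⟨b, hb0, hb⟩ := exists_norm_le_of_continuousOn hB
  have hm : MeasurableSet (Ioc 0 t) := measurableSet_Ioc
  have hui : Integrable ((Ioc 0 t).indicator u) := by
    rw [integrable_indicator_iff hm, ← intervalIntegrable_iff_integrableOn_Ioc_of_le ht.1]
    refine ContinuousOn.intervalIntegrable ?_
    rw [uIcc_of_le ht.1]
    exact hu.mono (Icc_subset_Icc_right ht.2)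
  have hωi : Integrable ((Ioc 0 t).indicator (omega α)) := by
    rw [integrable_indicator_iff hm, ← intervalIntegrable_iff_integrableOn_Ioc_of_le ht.1]
    exact (intervalIntegral.intervalIntegrable_rpow' (by linarith : -1 < α - 1)).div_const _
  have hBm : AEStronglyMeasurable ((Ioc 0 t).indicator B) volume := by
    rw [aestronglyMeasurable_indicator_iff hm]
    exact (hB.mono hsub).aestronglyMeasurable hm
  -- Cutting u, `ω_α` and B off to (0,t] encodes the triangle 0 < s < z ≤ t, as the cutoff of
  -- `ω_α(z-s)` forces s < z. Joint integrability is then that of a convolution integrand of two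
  -- integrable functions, times the bounded factor B.
  have hconv := hui.convolution_integrand (ContinuousLinearMap.lsmul ℝ ℝ : ℝ →L[ℝ] Y →L[ℝ] Y).flip
    hωi
  set H : ℝ → ℝ → Y := fun z s => (Ioc 0 t).indicator B z
    ((Ioc 0 t).indicator (omega α) (z - s) • (Ioc 0 t).indicator u s) with hH
  have hHi : Integrable (Function.uncurry H) (volume.prod volume) := by
    refine (hconv.norm.const_mul b).mono' ?_ (ae_of_all _ fun p => ?_)
    · exact (ContinuousLinearMap.id ℝ (Y →L[ℝ] Y)).aestronglyMeasurable_comp₂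
        (hBm.comp_fst (ν := (volume : Measure ℝ))) hconv.aestronglyMeasurable
    · refine ContinuousLinearMap.le_of_opNorm_le _ ?_ _
      by_cases hz : p.1 ∈ Ioc 0 t
      · rw [indicator_of_mem hz]; exact hb _ (hsub hz)
      · rw [indicator_of_notMem hz, norm_zero]; exact hb0
  have h1 : ∀ s ∈ Ioc 0 t, ∫ z, H z s = (∫ z in s..t, omega α (z - s) • B z) (u s) := by
    intro s hs
    rw [ContinuousLinearMap.intervalIntegral_apply
      (intervalIntegrable_omega_smul hα hB hs.1.le hs.2 ht.2),
      intervalIntegral.integral_of_le hs.2, ← integral_indicator measurableSet_Ioc]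
    congr 1
    ext z
    simp only [hH]
    rw [indicator_of_mem hs]
    by_cases hz : z ∈ Ioc s t
    · rw [indicator_of_mem hz, indicator_of_mem (show z ∈ Ioc 0 t from ⟨hs.1.trans hz.1, hz.2⟩),
        indicator_of_mem (show z - s ∈ Ioc 0 t from ⟨sub_pos.2 hz.1, by linarith [hz.2, hs.1]⟩), map_smul]
      rfl
    · rw [indicator_of_notMem hz]
      by_cases hzt : z ≤ t
      · have : z - s ∉ Ioc 0 t := fun h => hz ⟨sub_pos.1 h.1, hzt⟩
        rw [indicator_of_notMem this, zero_smul, map_zero]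
      · have : z ∉ Ioc 0 t := fun h => hzt h.2
        rw [indicator_of_notMem this, _root_.zero_apply]
  have h2 : ∀ z ∈ Ioc 0 t, ∫ s, H z s = B z (frac α u z) := by
    intro z hz
    have hzT := hsub hz
    have hi := intervalIntegrable_omega_sub_smul hα hu hzT
    rw [frac_eq_integral hα hz.1.le, ← ContinuousLinearMap.intervalIntegral_comp_comm _ hi,
      intervalIntegral.integral_of_le hz.1.le, integral_Ioc_eq_integral_Ioo,
      ← integral_indicator measurableSet_Ioo]
    congr 1
    ext s
    simp only [hH]
    rw [indicator_of_mem hz]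
    by_cases hs : s ∈ Ioo 0 z
    · rw [indicator_of_mem hs, indicator_of_mem (show s ∈ Ioc 0 t from ⟨hs.1, hs.2.le.trans hz.2⟩),
        indicator_of_mem (show z - s ∈ Ioc 0 t from ⟨sub_pos.2 hs.2, by linarith [hz.2, hs.1]⟩)]
    · rw [indicator_of_notMem hs]
      by_cases hs0 : 0 < s
      · have : z - s ∉ Ioc 0 t := fun h => hs ⟨hs0, sub_pos.1 h.1⟩
        rw [indicator_of_notMem this, zero_smul, map_zero]
      · have : s ∉ Ioc 0 t := fun h => hs0 h.1
        rw [indicator_of_notMem this, smul_zero, map_zero]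
  have h3 : ∀ s, s ∉ Ioc 0 t → ∫ z, H z s = 0 := fun s hs => by
    simp only [hH, indicator_of_notMem hs, smul_zero, map_zero, integral_zero]
  have h4 : ∀ z, z ∉ Ioc 0 t → ∫ s, H z s = 0 := fun z hz => by
    simp only [hH, indicator_of_notMem hz, _root_.zero_apply, integral_zero]
  constructor
  · rw [intervalIntegrable_iff_integrableOn_Ioc_of_le ht.1]
    exact hHi.integral_prod_right.integrableOn.congr_fun h1 hm
  · rw [intervalIntegral.integral_of_le ht.1, intervalIntegral.integral_of_le ht.1,
      ← setIntegral_congr_fun hm h1, ← setIntegral_congr_fun hm h2,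
      setIntegral_eq_integral_of_forall_compl_eq_zero h3,
      setIntegral_eq_integral_of_forall_compl_eq_zero h4]
    exact (integral_integral_swap hHi).symm

end kernel

/-! ### The weighted spaces -/

section weightedNorm

variable {Y : Type*} [NormedAddCommGroup Y] [NormedSpace ℝ Y] {T α : ℝ} {m : ℕ} {v : ℝ → Y}

lemma weightedSeminorm_nonneg (j : ℕ) : 0 ≤ weightedSeminorm α T j v := by
  refine Real.sSup_nonneg ?_
  rintro _ ⟨t, ht, rfl⟩
  exact mul_nonneg (Real.rpow_nonneg ht.1.le _) (norm_nonneg _)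

lemma weightedNorm_nonneg : 0 ≤ weightedNorm m α T v := by
  refine add_nonneg (Real.sSup_nonneg ?_)
    (Finset.sum_nonneg fun j _ => weightedSeminorm_nonneg j)
  rintro _ ⟨t, -, rfl⟩
  exact norm_nonneg _

lemma MemWeighted.weightedBound (h : MemWeighted m α T v) :
    WeightedBound T α m v (weightedNorm m α T v) := by
  have hs : ∀ j ∈ Finset.Icc 1 m, weightedSeminorm α T j v ≤ weightedNorm m α T v := by
    intro j hj
    refine (Finset.single_le_sum (f := fun j => weightedSeminorm α T j v)
      (fun j _ => weightedSeminorm_nonneg j) hj).trans (le_add_of_nonneg_left ?_)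
    refine Real.sSup_nonneg ?_
    rintro _ ⟨t, -, rfl⟩
    exact norm_nonneg _
  refine ⟨h.continuousOn, fun t ht => ?_, fun k hk => ?_⟩
  · refine le_add_of_le_of_nonneg (le_csSup ?_ (mem_image_of_mem _ ht))
      (Finset.sum_nonneg fun j _ => weightedSeminorm_nonneg j)
    exact (isCompact_Icc.image_of_continuousOn h.continuousOn.norm).bddAbove
  · subst hk
    have hc := h.contDiffOn
    push_cast at hc
    obtain ⟨hd, -, hc'⟩ := (contDiffOn_succ_iff_derivWithin (uniqueDiffOn_Ioc _ _)).1 hc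
    refine ⟨derivWithin v (Ioc 0 T), fun t ht => (hd t ht).hasDerivWithinAt,
      (DerivBound.iff_iteratedDerivWithin _ _ _ _).2 ⟨hc', fun j hj t ht => ?_⟩⟩
    have hmem : j + 1 ∈ Finset.Icc 1 (k + 1) := Finset.mem_Icc.2 ⟨by omega, by omega⟩
    have h1 : t ^ (((j + 1 : ℕ) : ℝ) - α) * ‖iteratedDerivWithin (j + 1) v (Ioc 0 T) t‖
        ≤ weightedNorm (k + 1) α T v :=
      (le_csSup (h.bounded _ hmem) (mem_image_of_mem _ ht)).trans (hs _ hmem)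
    rw [iteratedDerivWithin_succ'] at h1
    have h2 : (t ^ (((j + 1 : ℕ) : ℝ) - α))⁻¹ = t ^ (α - 1 - j) := by
      rw [← Real.rpow_neg ht.1.le]; congr 1; push_cast; ring
    rw [← h2, ← div_eq_mul_inv, le_div_iff₀ (Real.rpow_pos_of_pos ht.1 _), mul_comm]
    exact h1

/-- The factor `1 + m` counts one A for the maximum norm and one for each of the m seminorms. -/
lemma WeightedBound.memWeighted {A : ℝ} (hT : 0 < T) (h : WeightedBound T α m v A) :
    MemWeighted m α T v ∧ weightedNorm m α T v ≤ (1 + m) * A := by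
  have hA := h.nonneg hT.le
  have key : ContDiffOn ℝ m v (Ioc 0 T) ∧ ∀ j ∈ Finset.Icc 1 m,
      ∀ x ∈ weightedValues α T j v, x ≤ A := by
    cases m with
    | zero =>
      exact ⟨contDiffOn_zero.2 (h.continuousOn.mono Ioc_subset_Icc_self),
        fun j hj => by simp at hj⟩
    | succ k =>
      obtain ⟨v', h1, h2⟩ := h.deriv k rfl
      have hu := uniqueDiffOn_Ioc (0 : ℝ) T
      obtain ⟨h3, h4⟩ := (DerivBound.iff_iteratedDerivWithin _ _ _ _).1
        (h2.congr fun t ht => (h1 t ht).derivWithin (hu t ht))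
      refine ⟨?_, ?_⟩
      · push_cast
        exact (contDiffOn_succ_iff_derivWithin hu).2
          ⟨fun t ht => (h1 t ht).differentiableWithinAt, by simp, h3⟩
      · rintro j hj _ ⟨t, ht, rfl⟩
        obtain ⟨i, rfl⟩ : ∃ i, j = i + 1 := ⟨j - 1, by have := (Finset.mem_Icc.1 hj).1; omega⟩
        have h5 := h4 i (by have := (Finset.mem_Icc.1 hj).2; omega) t ht
        have h6 : t ^ (α - 1 - i) = (t ^ (((i + 1 : ℕ) : ℝ) - α))⁻¹ := by
          rw [← Real.rpow_neg ht.1.le]; congr 1; push_cast; ring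
        rw [h6, ← div_eq_mul_inv, le_div_iff₀ (Real.rpow_pos_of_pos ht.1 _), mul_comm] at h5
        simp only [iteratedDerivWithin_succ']
        exact h5
  refine ⟨⟨h.continuousOn, key.1, fun j hj => ⟨A, key.2 j hj⟩⟩, ?_⟩
  have h1 : sSup ((fun t => ‖v t‖) '' Icc 0 T) ≤ A := by
    refine Real.sSup_le ?_ hA
    rintro _ ⟨t, ht, rfl⟩
    exact h.bound t ht
  have h2 : ∑ j ∈ Finset.Icc 1 m, weightedSeminorm α T j v ≤ m * A := by
    refine (Finset.sum_le_card_nsmul _ _ A fun j hj => Real.sSup_le (key.2 j hj) hA).trans_eq ?_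
    simp
  rw [weightedNorm, add_mul, one_mul]
  exact add_le_add h1 h2

end weightedNorm

/-! ### The projected operators -/

section operators

variable {d : ℕ} {Ω : Opens (E d)}

/-- The pairing of `L_2(Ω)` with `i`-th partial derivatives. -/
def pairGrad (i : Fin d) : L2 Ω →L[ℝ] StrongDual ℝ (H10 Ω) :=
  (innerSL ℝ).bilinearComp (ContinuousLinearMap.id ℝ (L2 Ω)) (grad Ω i)

/-- The pairing of `L_2(Ω)` with `H¹₀(Ω)`. -/
def pairVal : L2 Ω →L[ℝ] StrongDual ℝ (H10 Ω) :=
  (innerSL ℝ).bilinearComp (ContinuousLinearMap.id ℝ (L2 Ω)) (val Ω)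

/-- The coefficient enters only through the bounded linear map `mulL`, so its smoothness in time
passes to the operator. -/
lemma drift_eq_sum (F : Fin d → W1inf Ω) :
    drift F = ∑ i, (pairGrad i).comp (mulL Ω (F i).1.1) := by
  ext v w
  rw [drift_apply]
  simp [pairGrad]

lemma reaction_eq_comp (a : Linf Ω) : reaction a = pairVal.comp (mulL Ω a) := by
  ext v w
  rw [reaction_apply]
  simp [pairVal]

section contDiffOn

variable {c : Coeffs Ω} {T : ℝ} {n : WithTop ℕ∞}

lemma contDiffOn_reaction {a : ℝ → Linf Ω} (ha : ContDiffOn ℝ n a (Icc 0 T)) :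
    ContDiffOn ℝ n (fun t => reaction (a t)) (Icc 0 T) := by
  simp only [reaction_eq_comp]
  exact contDiffOn_const.clm_comp ((mulL Ω).contDiff.comp_contDiffOn ha)

lemma contDiffOn_drift {F : ℝ → Fin d → W1inf Ω} (hF : ContDiffOn ℝ n F (Icc 0 T)) :
    ContDiffOn ℝ n (fun t => drift (F t)) (Icc 0 T) := by
  simp only [drift_eq_sum]
  refine ContDiffOn.sum fun i _ => contDiffOn_const.clm_comp
    ((mulL Ω).contDiff.comp_contDiffOn ?_)
  exact ((ContinuousLinearMap.fst ℝ (Linf Ω) (Fin d → Linf Ω)).comp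
    (W1inf Ω).subtypeL).contDiff.comp_contDiffOn (contDiffOn_pi.1 hF i)

lemma contDiffOn_comp_val {R : ℝ → L2 Ω →L[ℝ] StrongDual ℝ (H10 Ω)}
    (hR : ContDiffOn ℝ n R (Icc 0 T)) :
    ContDiffOn ℝ n (fun t => (R t).comp (val Ω)) (Icc 0 T) :=
  hR.clm_comp contDiffOn_const

lemma contDiffOn_K1 (hF : ContDiffOn ℝ n c.F (Icc 0 T)) (ha : ContDiffOn ℝ n c.a (Icc 0 T)) :
    ContDiffOn ℝ n (K1 c) (Icc 0 T) :=
  (contDiffOn_const.sub (contDiffOn_comp_val (contDiffOn_drift hF))).add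
    (contDiffOn_comp_val (contDiffOn_reaction ha))

lemma contDiffOn_K1' (hF : ContDiffOn ℝ n (derivWithin c.F (Icc 0 T)) (Icc 0 T))
    (ha : ContDiffOn ℝ n (derivWithin c.a (Icc 0 T)) (Icc 0 T)) :
    ContDiffOn ℝ n (K1' c T) (Icc 0 T) := by
  have := (contDiffOn_comp_val (contDiffOn_drift hF)).neg.add
    (contDiffOn_comp_val (contDiffOn_reaction ha))
  refine this.congr fun t _ => ?_
  ext v w
  simp [K1']

lemma contDiffOn_K2 (hG : ContDiffOn ℝ n c.G (Icc 0 T)) (hb : ContDiffOn ℝ n c.b (Icc 0 T)) :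
    ContDiffOn ℝ n (fun t => (K2 c t).comp (val Ω)) (Icc 0 T) :=
  contDiffOn_comp_val ((contDiffOn_reaction hb).sub (contDiffOn_drift hG))

end contDiffOn

variable (X : Submodule ℝ (H10 Ω)) [FiniteDimensional ℝ X]

/-- The Riesz map of `X` for the `L_2` inner product, as a bounded operator. -/
def representCLM : StrongDual ℝ X →L[ℝ] X :=
  LinearMap.toContinuousLinearMap
    { toFun := fun ℓ => represent X (ℓ : X →ₗ[ℝ] ℝ)
      map_add' := fun ℓ ℓ' => by rw [← map_add]; rfl
      map_smul' := fun r ℓ => by rw [RingHom.id_apply, ← map_smul]; rfl }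

/-- The compression of a bounded operator `H¹₀(Ω) → H⁻¹(Ω)` to `X`. -/
def compress : (H10 Ω →L[ℝ] StrongDual ℝ (H10 Ω)) →L[ℝ] X →L[ℝ] X :=
  (ContinuousLinearMap.compL ℝ X (StrongDual ℝ (H10 Ω)) X
    ((representCLM X).comp
      ((ContinuousLinearMap.compL ℝ X (H10 Ω) ℝ).flip X.subtypeL))).comp
    ((ContinuousLinearMap.compL ℝ X (H10 Ω) (StrongDual ℝ (H10 Ω))).flip X.subtypeL)

lemma KX_eq_compress (c : Coeffs Ω) (α T t s : ℝ) : KX X c α T t s = compress X (K c α T t s) := by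
  ext v
  rfl

lemma contDiffOn_compress {T : ℝ} {n : WithTop ℕ∞} {R : ℝ → H10 Ω →L[ℝ] StrongDual ℝ (H10 Ω)}
    (hR : ContDiffOn ℝ n R (Icc 0 T)) : ContDiffOn ℝ n (fun t => compress X (R t)) (Icc 0 T) := by
  have h : ContDiff ℝ n (compress X) :=
    ContinuousLinearMap.contDiff (𝕜 := ℝ) (E := H10 Ω →L[ℝ] StrongDual ℝ (H10 Ω))
      (F := X →L[ℝ] X) (compress X)
  exact h.comp_contDiffOn hR

/-- The `L_2` projection onto `X` as a bounded operator. -/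
def projXCLM : L2 Ω →L[ℝ] X :=
  (representCLM X).comp
    (((ContinuousLinearMap.compL ℝ X (L2 Ω) ℝ).flip (valX X)).comp (innerSL ℝ))

variable {c : Coeffs Ω} {T α : ℝ}

/-- Compression to X is bounded and linear, so it passes through the Bochner integral in the kernel.
-/
lemma KX_eq (hα : 0 < α) (hK' : ContinuousOn (K1' c T) (Icc 0 T)) {s t : ℝ} (hs : 0 ≤ s)
    (hst : s ≤ t) (ht : t ≤ T) :
    KX X c α T t s = omega α (t - s) • compress X (K1 c t) + compress X ((K2 c s).comp (val Ω))
      - ∫ z in s..t, omega α (z - s) • compress X (K1' c T z) := by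
  have : CompleteSpace X := FiniteDimensional.complete ℝ X
  rw [KX_eq_compress, K]
  exact map_weakly_singular_kernel (Y := X →L[ℝ] X) (Z := H10 Ω →L[ℝ] StrongDual ℝ (H10 Ω))
    (compress X) hα (K1 c t) ((K2 c s).comp (val Ω)) hK' hs hst ht _

/-- The integral operator of the projected equation, in terms of fractional integrals. -/
lemma integral_KX_apply (hα : 0 < α) (hK' : ContinuousOn (K1' c T) (Icc 0 T))
    (hK2 : ContinuousOn (fun t => (K2 c t).comp (val Ω)) (Icc 0 T)) {u : ℝ → X}
    (hu : ContinuousOn u (Icc 0 T)) {t : ℝ} (ht : t ∈ Icc 0 T) :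
    IntervalIntegrable (fun s => KX X c α T t s (u s)) volume 0 t ∧
      ∫ s in (0 : ℝ)..t, KX X c α T t s (u s)
        = volterraOp α (fun t => compress X (K1 c t)) (fun t => compress X (K1' c T t))
            (fun t => compress X ((K2 c t).comp (val Ω))) u t := by
  have : CompleteSpace X := FiniteDimensional.complete ℝ X
  have hB' : ContinuousOn (fun t => compress X (K1' c T t)) (Icc 0 T) :=
    (compress X).continuous.comp_continuousOn hK'
  have hD : ContinuousOn (fun t => compress X ((K2 c t).comp (val Ω))) (Icc 0 T) :=
    (compress X).continuous.comp_continuousOn hK2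
  obtain ⟨i3, e3⟩ := integral_kernel_apply hα hB' hu ht
  have hsub : Icc 0 t ⊆ Icc 0 T := Icc_subset_Icc_right ht.2
  have i2 : IntervalIntegrable (fun s => compress X ((K2 c s).comp (val Ω)) (u s)) volume 0 t := by
    refine ContinuousOn.intervalIntegrable ?_
    rw [uIcc_of_le ht.1]
    exact (hD.clm_apply hu).mono hsub
  have i4 : IntervalIntegrable (fun s => compress X (K1' c T s) (frac α u s)) volume 0 t := by
    refine ContinuousOn.intervalIntegrable ?_
    rw [uIcc_of_le ht.1]
    exact (hB'.clm_apply (continuousOn_frac hα hu)).mono hsub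
  have i0 := intervalIntegrable_omega_sub_smul hα hu ht
  have i1 : IntervalIntegrable (fun s => compress X (K1 c t) (omega α (t - s) • u s)) volume 0 t :=
    ⟨(compress X (K1 c t)).integrable_comp i0.1, (compress X (K1 c t)).integrable_comp i0.2⟩
  have hpt : ∀ s ∈ Icc 0 t, KX X c α T t s (u s)
      = compress X (K1 c t) (omega α (t - s) • u s) + compress X ((K2 c s).comp (val Ω)) (u s)
        - (∫ z in s..t, omega α (z - s) • compress X (K1' c T z)) (u s) := by
    intro s hs
    rw [KX_eq X hα hK' hs.1 hs.2 ht.2, map_smul]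
    rfl
  constructor
  · refine ((i1.add i2).sub i3).congr fun s hs => ?_
    rw [uIoc_of_le ht.1] at hs
    exact (hpt s ⟨hs.1.le, hs.2⟩).symm
  · have : ∫ s in (0 : ℝ)..t, KX X c α T t s (u s) = ∫ s in (0 : ℝ)..t,
        (compress X (K1 c t) (omega α (t - s) • u s) + compress X ((K2 c s).comp (val Ω)) (u s)
        - (∫ z in s..t, omega α (z - s) • compress X (K1' c T z)) (u s)) :=
      intervalIntegral.integral_congr fun s hs => by
        rw [uIcc_of_le ht.1] at hs
        exact hpt s hs
    rw [this, intervalIntegral.integral_sub (i1.add i2) i3, intervalIntegral.integral_add i1 i2,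
      e3, ContinuousLinearMap.intervalIntegral_comp_comm _ i0, ← frac_eq_integral hα ht.1,
      volterraOp, intervalIntegral.integral_sub i2 i4, add_sub_assoc]

/-- The projected data belong to the weighted space. -/
lemma weightedBound_fX (hT : 0 < T) (hα : 0 < α) {m : ℕ} (hm : 1 ≤ m) (u₀ : L2 Ω) (g : ℝ → L2 Ω)
    (M : ℝ) (hg : ContDiffOn ℝ m g (Ioc 0 T))
    (hM : ∀ i ∈ Finset.Icc 1 m, ∀ t ∈ Ioc 0 T,
      ‖iteratedDerivWithin (i - 1) g (Ioc 0 T) t‖ ≤ M * t ^ (α - (i : ℝ))) :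
    0 ≤ M ∧ WeightedBound T α m (fX X u₀ g)
      (‖projXCLM X‖ * (1 + T ^ α / α) * (‖u₀‖ + M)) := by
  -- The hypothesis with i = j + 1 bounds the j-th derivative of g by `M t^(α-1-j)`: g has order m -
  -- 1, its primitive order m.
  have hgb : DerivBound T (m - 1) (α - 1) g M := by
    refine (DerivBound.iff_iteratedDerivWithin _ _ _ _).2
      ⟨hg.of_le (by exact_mod_cast m.sub_le 1), fun j hj t ht => ?_⟩
    have := hM (j + 1) (Finset.mem_Icc.2 ⟨by omega, by omega⟩) t ht
    rw [Nat.add_sub_cancel] at this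
    push_cast at this
    rwa [sub_sub, add_comm (1 : ℝ)]
  have hM0 := hgb.nonneg hT
  have hα' : -1 < α - 1 := by linarith
  have hfX : fX X u₀ g = fun t => projXCLM X (u₀ + ∫ s in (0 : ℝ)..t, g s) := rfl
  have hTα : 0 ≤ T ^ α / α := by positivity
  have hP := norm_nonneg (projXCLM X)
  have hu₀ := norm_nonneg u₀
  refine ⟨hM0, ?_, fun t ht => ?_, fun j hj => ?_⟩
  · rw [hfX]
    exact (projXCLM X).continuous.comp_continuousOn (continuousOn_const.add
      (continuousOn_primitive_of_norm_le_rpow hT.le hα' hgb.continuousOn hgb.bound))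
  · have h3 := norm_primitive_le hα' hgb.bound ht
    rw [sub_add_cancel] at h3
    have h4 : t ^ α ≤ T ^ α := Real.rpow_le_rpow ht.1 ht.2 hα.le
    rw [hfX, mul_assoc]
    refine (projXCLM X).le_opNorm_of_le ((norm_add_le_of_le le_rfl h3).trans ?_)
    calc ‖u₀‖ + M * (t ^ α / α) ≤ ‖u₀‖ + M * (T ^ α / α) := by gcongr
      _ ≤ ‖u₀‖ + M * (T ^ α / α) + (M + T ^ α / α * ‖u₀‖) :=
          le_add_of_nonneg_right (by positivity)
      _ = _ := by ring
  · obtain rfl : j = m - 1 := by omega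
    refine ⟨fun t => projXCLM X (g t), fun t ht => ?_, (hgb.clm (projXCLM X)).mono ?_⟩
    · rw [hfX]
      exact (projXCLM X).hasFDerivAt.comp_hasDerivWithinAt t
        ((hasDerivWithinAt_primitive hα' hgb.continuousOn hgb.bound ht).const_add u₀)
    · rw [mul_assoc]
      gcongr
      nlinarith [mul_nonneg hTα hM0, mul_nonneg hTα hu₀]

end operators

end FracPDE

end

/-! ### Well-posedness and regularity of the projected equation -/

open FracPDE in
theorem theorem3p2 {d : ℕ} (hd : 1 ≤ d) (Ω : TopologicalSpace.Opens (E d))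
    (hΩ : Bornology.IsBounded (Ω : Set (E d)))
    (α T : ℝ) (hα0 : 0 < α) (hα1 : α < 1) (hT : 0 < T)
    (m : ℕ) (hm : 1 ≤ m) (c : Coeffs Ω)
    -- `κ(x)` is symmetric positive-definite with minimal eigenvalue bounded away from zero
    (hκ : ∃ lam > 0, ∀ᵐ x ∂(vol Ω), (Matrix.of fun i j => c.κ i j x).PosDef ∧
      ∀ μ ∈ spectrum ℝ (Matrix.of fun i j => c.κ i j x), lam ≤ μ)
    (hF : ContDiffOn ℝ (m + 1 : ℕ) c.F (Set.Icc 0 T))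
    (hG : ContDiffOn ℝ (m + 1 : ℕ) c.G (Set.Icc 0 T))
    (ha : ContDiffOn ℝ m c.a (Set.Icc 0 T))
    (hb : ContDiffOn ℝ m c.b (Set.Icc 0 T))
    (X : Submodule ℝ (H10 Ω)) [FiniteDimensional ℝ X] :
    ∃ C₁ > 0, ∃ C₂ > 0, ∀ (u₀ : L2 Ω) (g : ℝ → L2 Ω) (M : ℝ),
      ContDiffOn ℝ m g (Set.Ioc 0 T) →
      (∀ i ∈ Finset.Icc 1 m, ∀ t ∈ Set.Ioc 0 T,
        ‖iteratedDerivWithin (i - 1) g (Set.Ioc 0 T) t‖ ≤ M * t ^ (α - (i : ℝ))) →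
      ∃ uX : ℝ → X, IsSolution X c α T u₀ g uX ∧
        (∀ v : ℝ → X, IsSolution X c α T u₀ g v → Set.EqOn v uX (Set.Icc 0 T)) ∧
        MemWeighted m α T (fX X u₀ g) ∧ MemWeighted m α T uX ∧
        weightedNorm m α T uX ≤ C₁ * weightedNorm m α T (fX X u₀ g) ∧
        C₁ * weightedNorm m α T (fX X u₀ g) ≤ C₂ * (‖u₀‖ + M) := by
  have : CompleteSpace X := FiniteDimensional.complete ℝ X
  have hFm : ContDiffOn ℝ m c.F (Icc 0 T) := hF.of_le (by exact_mod_cast m.le_succ)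
  have hGm : ContDiffOn ℝ m c.G (Icc 0 T) := hG.of_le (by exact_mod_cast m.le_succ)
  have hu := uniqueDiffOn_Icc hT
  have hK1 := contDiffOn_K1 hFm ha
  -- Differentiating the coefficients loses one order, which the regularity lemma allows since this
  -- operator occurs only under an integral.
  have hK1' : ContDiffOn ℝ (m - 1 : ℕ) (K1' c T) (Icc 0 T) :=
    contDiffOn_K1' (hFm.derivWithin hu (by exact_mod_cast (Nat.sub_add_cancel hm).le))
      (ha.derivWithin hu (by exact_mod_cast (Nat.sub_add_cancel hm).le))
  have hK2 := contDiffOn_K2 hGm hb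
  have hB := contDiffOn_compress X hK1
  have hB' := contDiffOn_compress X hK1'
  have hD := contDiffOn_compress X hK2
  have hV := isVolterra_volterraOp hα0 hα1.le hB.continuousOn hB'.continuousOn hD.continuousOn
  obtain ⟨C, hC, hreg⟩ := exists_weightedBound_of_volterraOp_eq hT hα0 hα1.le m hB hB' hD
  have heqn : ∀ {u : ℝ → X}, ContinuousOn u (Icc 0 T) → _ := fun {u} hu {t} ht =>
    integral_KX_apply (t := t) X hα0 hK1'.continuousOn hK2.continuousOn hu ht
  set P := ‖projXCLM X‖ * (1 + T ^ α / α)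
  have hP : 0 ≤ P := by positivity
  -- The added 1, here and in the second constant, only secures positivity.
  set C₁ := (1 + m) * C + 1
  have hC₁ : 0 < C₁ := by positivity
  refine ⟨C₁, hC₁, C₁ * ((1 + m) * P) + 1, by positivity, fun u₀ g M hg hM => ?_⟩
  obtain ⟨hM0, hf⟩ := weightedBound_fX X hT hα0 hm u₀ g M hg hM
  obtain ⟨hfm, hfn⟩ := hf.memWeighted hT
  obtain ⟨u, huc, hue⟩ := hV.exists_solution (half_pos hα0) hT.le hfm.continuousOn
  obtain ⟨hum, hun⟩ := (hreg u _ _ huc hfm.weightedBound hue).memWeighted hT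
  have hw : 0 ≤ weightedNorm m α T (fX X u₀ g) := weightedNorm_nonneg
  refine ⟨u, ⟨huc, fun t ht => ⟨(heqn huc ht).1, ?_⟩⟩, fun v hv => ?_, hfm, hum, ?_, ?_⟩
  · rw [(heqn huc ht).2]
    exact hue t ht
  · refine hV.eqOn_of_add_eq (half_pos hα0) hv.continuousOn huc fun t ht => ?_
    rw [hue t ht, ← (hv.eqn t ht).2, (heqn hv.continuousOn ht).2]
  · refine hun.trans ?_
    rw [← mul_assoc]
    exact mul_le_mul_of_nonneg_right (le_add_of_nonneg_right zero_le_one) hw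
  · have h0 : 0 ≤ ‖u₀‖ + M := by positivity
    calc C₁ * weightedNorm m α T (fX X u₀ g) ≤ C₁ * ((1 + m) * (P * (‖u₀‖ + M))) := by gcongr
      _ = C₁ * ((1 + m) * P) * (‖u₀‖ + M) := by ring
      _ ≤ _ := by
          gcongr
          exact le_add_of_nonneg_right zero_le_one
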